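/- Let $\Bbbk$ be an arbitrary field, $\Gamma$ a finite connected simple graph with vertex set $V$, and $\mathsf{C}\subseteq V$ a non-empty set of vertices. *The algebra.* Let $\Gamma_{\rightleftarrows}$ be the quiver with vertex set $V$ that has arrows $i\to j$ and $j\to i$ for every edge $i - j$ of $\Gamma$, and two loops $s_i,t_i$ at every vertex $i$. In its path algebra over $\Bbbk$ write $i|j$ for the arrow $i\to j$, compose paths from left to right, identify a vertex $i$ with the idempotent given by its length zero path, and put $\mathtt{x}_i=s_i-t_i$ if $\operatorname{char}\Bbbk\neq 2$ and $\mathtt{x}_i=s_i$ if $\operatorname{char}\Bbbk=2$. The zigzag algebra $\mathrm{Z}(\Gamma)$ is the quotient of the path algebra by the relations: (a) every path that involves (at least) three distinct vertices is zero; (b) $s_it_i=t_is_i$, $s_i+t_i=0$ and $s_it_i=0$ for all $i$; (c) $(i|j)(j|i)=\mathtt{x}_i$ for every edge $i - j$; and, if $\Gamma$ has exactly two vertices, (d) every path of length three is zero, where loops have length two. The zigzag algebra with vertex condition $\mathrm{Z}^{\mathsf{C}}(\Gamma)$ is the quotient of $\mathrm{Z}(\Gamma)$ by the two-sided ideal generated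 by $\mathtt{x}_c$, $c\in\mathsf{C}$. *Quasi-heredity.* A two-sided ideal $J$ of a finite-dimensional algebra $R$ is called hereditary if $J$ is projective as a left $R$-module, $JJ=J$, and $J\operatorname{Rad}(R)J=0$, where $\operatorname{Rad}(R)$ is the Jacobson radical. A hereditary chain of $R$ is a chain $0=J_0\subsetneq J_1\subsetneq\dots\subsetneq J_m=R$, $m\geq 1$, of two-sided ideals such that $J_l/J_{l-1}$ is a hereditary ideal of $R/J_{l-1}$ for $1\leq l\leq m$. A finite-dimensional algebra is quasi-hereditary if it has a hereditary chain. **Theorem.** $\mathrm{Z}^{\mathsf{C}}(\Gamma)$ is quasi-hereditary if and only if $\Gamma$ is a graph of finite type $\mathsf{A}_n$ for some $n\geq 1$, i.e. a path $v_1 - v_2 - \cdots - v_n$, and $\mathsf{C}$ consists of exactly one of its end vertices, $\mathsf{C}=\{v_1\}$ or $\mathsf{C}=\{v_n\}$. Moreover, if $\Gamma$ is the path $v_1 - v_2 - \cdots - v_n$ and $\mathsf{C}=\{v_1\}$, then the two-sided ideals $J_l$ of $\mathrm{Z}^{\mathsf{C}}(\Gamma)$ generated by the idempotents $v_1+\dots+v_l$,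 $0\leq l\leq n$, form a hereditary chain (for $\mathsf{C}=\{v_n\}$, reverse the enumeration). -/

import Mathlib

universe u v w

/-! ### Path algebras of finite quivers -/

/-- Generators of the path algebra of a quiver: the vertices (length zero paths) and the arrows. -/
inductive PathGen (Q : Type u) [Quiver.{v} Q] : Type (max u v)
  | vertex (i : Q) : PathGen Q
  | arrow {i j : Q} (a : i ⟶ j) : PathGen Q

/-- Defining relations of the path algebra. Products are read from left to right: `a * b` is the
path `a` followed by the path `b`. -/
inductive PathRel (k : Type w) [Field k] (Q : Type u) [Quiver.{v} Q] [Fintype Q] :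
    FreeAlgebra k (PathGen Q) → FreeAlgebra k (PathGen Q) → Prop
  | idem (i : Q) : PathRel k Q
      (FreeAlgebra.ι k (PathGen.vertex i) * FreeAlgebra.ι k (PathGen.vertex i))
      (FreeAlgebra.ι k (PathGen.vertex i))
  | orth (i j : Q) (h : i ≠ j) : PathRel k Q
      (FreeAlgebra.ι k (PathGen.vertex i) * FreeAlgebra.ι k (PathGen.vertex j)) 0
  | one : PathRel k Q (∑ i : Q, FreeAlgebra.ι k (PathGen.vertex i)) 1
  | source {i j : Q} (a : i ⟶ j) : PathRel k Q
      (FreeAlgebra.ι k (PathGen.vertex i) * FreeAlgebra.ι k (PathGen.arrow a))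
      (FreeAlgebra.ι k (PathGen.arrow a))
  | target {i j : Q} (a : i ⟶ j) : PathRel k Q
      (FreeAlgebra.ι k (PathGen.arrow a) * FreeAlgebra.ι k (PathGen.vertex j))
      (FreeAlgebra.ι k (PathGen.arrow a))

/-- The path algebra over `k` of a quiver `Q` with finitely many vertices. -/
def PathAlgebra (k : Type w) [Field k] (Q : Type u) [Quiver.{v} Q] [Fintype Q] :
    Type (max u v w) :=
  RingQuot (PathRel k Q)

namespace PathAlgebra

variable (k : Type w) [Field k] {Q : Type u} [Quiver.{v} Q] [Fintype Q]

noncomputable instance : Ring (PathAlgebra k Q) := inferInstanceAs (Ring (RingQuot (PathRel k Q)))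

noncomputable instance : Algebra k (PathAlgebra k Q) :=
  inferInstanceAs (Algebra k (RingQuot (PathRel k Q)))

/-- The quotient map from the free algebra. -/
noncomputable def mk : FreeAlgebra k (PathGen Q) →ₐ[k] PathAlgebra k Q :=
  RingQuot.mkAlgHom k (PathRel k Q)

/-- The vertex idempotent (length zero path) at `i`. -/
noncomputable def vertex (i : Q) : PathAlgebra k Q :=
  mk k (FreeAlgebra.ι k (PathGen.vertex i))

/-- An arrow as an element of the path algebra. -/
noncomputable def arrow {i j : Q} (a : i ⟶ j) : PathAlgebra k Q :=
  mk k (FreeAlgebra.ι k (PathGen.arrow a))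

/-- A path as an element of the path algebra. -/
noncomputable def ofPath {i : Q} : {j : Q} → Quiver.Path i j → PathAlgebra k Q
  | _, Quiver.Path.nil => vertex k i
  | _, Quiver.Path.cons p a => ofPath p * arrow k a

end PathAlgebra

/-! ### Zigzag algebras -/

/-- The vertex set of the double graph of `Γ`. -/
def DoubleGraph {V : Type u} (_Γ : SimpleGraph V) : Type u := V

/-- The arrows of the double graph of `Γ`: each edge is doubled into a pair of opposite arrows,
and each vertex receives two loops `s` and `t`. -/
inductive DoubleArrow {V : Type u} (Γ : SimpleGraph V) : V → V → Type u
  | edge {i j : V} (h : Γ.Adj i j) : DoubleArrow Γ i j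
  | loopS (i : V) : DoubleArrow Γ i i
  | loopT (i : V) : DoubleArrow Γ i i

/-- The degree of an arrow: edges have degree one and loops have degree two. -/
def DoubleArrow.degree {V : Type u} {Γ : SimpleGraph V} {i j : V} : DoubleArrow Γ i j → ℕ
  | .edge _ => 1
  | .loopS _ => 2
  | .loopT _ => 2

namespace DoubleGraph

variable {V : Type u} {Γ : SimpleGraph V}

instance : Quiver (DoubleGraph Γ) := ⟨DoubleArrow Γ⟩

instance [Fintype V] : Fintype (DoubleGraph Γ) := inferInstanceAs (Fintype V)

/-- The length of a path in the double graph, where loops count twice. -/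
def pathDegree {i : DoubleGraph Γ} : {j : DoubleGraph Γ} → Quiver.Path i j → ℕ
  | _, Quiver.Path.nil => 0
  | _, Quiver.Path.cons p a => pathDegree p + DoubleArrow.degree a

/-- The path visits at least three distinct vertices. -/
def MeetsThree {i j : DoubleGraph Γ} (p : Quiver.Path i j) : Prop :=
  ∃ a ∈ p.vertices, ∃ b ∈ p.vertices, ∃ c ∈ p.vertices, a ≠ b ∧ a ≠ c ∧ b ≠ c

end DoubleGraph

section Elements

variable (k : Type w) [Field k] {V : Type u} [Fintype V] (Γ : SimpleGraph V)

/-- The path algebra of the double graph. -/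
abbrev DoublePathAlgebra : Type (max u w) := PathAlgebra k (DoubleGraph Γ)

/-- The arrow `i → j` attached to an edge `i — j`. -/
noncomputable def edgeElem {i j : V} (h : Γ.Adj i j) : DoublePathAlgebra k Γ :=
  PathAlgebra.arrow k (Q := DoubleGraph Γ) (i := i) (j := j) (DoubleArrow.edge h)

/-- The first loop at `i`. -/
noncomputable def loopSElem (i : V) : DoublePathAlgebra k Γ :=
  PathAlgebra.arrow k (Q := DoubleGraph Γ) (i := i) (j := i) (DoubleArrow.loopS i)

/-- The second loop at `i`. -/
noncomputable def loopTElem (i : V) : DoublePathAlgebra k Γ :=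
  PathAlgebra.arrow k (Q := DoubleGraph Γ) (i := i) (j := i) (DoubleArrow.loopT i)

open Classical in
/-- The volume element at `i`: the difference `s - t` of the two loops, respectively `s` in
characteristic two (where `s + t = 0` would force `s - t = 0`). -/
noncomputable def volumeElem (i : V) : DoublePathAlgebra k Γ :=
  if (2 : k) = 0 then loopSElem k Γ i else loopSElem k Γ i - loopTElem k Γ i

/-- Defining relations of the zigzag algebra. -/
inductive ZigzagRel : DoublePathAlgebra k Γ → DoublePathAlgebra k Γ → Prop
  | bounded {i j : DoubleGraph Γ} (p : Quiver.Path i j) (hp : DoubleGraph.MeetsThree p) :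
      ZigzagRel (PathAlgebra.ofPath k p) 0
  | loops_comm (i : V) :
      ZigzagRel (loopSElem k Γ i * loopTElem k Γ i) (loopTElem k Γ i * loopSElem k Γ i)
  | loops_add (i : V) : ZigzagRel (loopSElem k Γ i + loopTElem k Γ i) 0
  | loops_mul (i : V) : ZigzagRel (loopSElem k Γ i * loopTElem k Γ i) 0
  | zigzag {i j : V} (h : Γ.Adj i j) :
      ZigzagRel (edgeElem k Γ h * edgeElem k Γ h.symm) (volumeElem k Γ i)
  | two_vertices (hV : Fintype.card V = 2) {i j : DoubleGraph Γ} (p : Quiver.Path i j)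
      (hp : DoubleGraph.pathDegree p = 3) : ZigzagRel (PathAlgebra.ofPath k p) 0

/-- The zigzag algebra of `Γ`. -/
def ZigzagAlgebra : Type (max u w) := RingQuot (ZigzagRel k Γ)

noncomputable instance : Ring (ZigzagAlgebra k Γ) := inferInstanceAs (Ring (RingQuot (ZigzagRel k Γ)))

noncomputable instance : Algebra k (ZigzagAlgebra k Γ) :=
  inferInstanceAs (Algebra k (RingQuot (ZigzagRel k Γ)))

/-- The quotient map from the path algebra of the double graph. -/
noncomputable def ZigzagAlgebra.mk : DoublePathAlgebra k Γ →ₐ[k] ZigzagAlgebra k Γ :=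
  RingQuot.mkAlgHom k (ZigzagRel k Γ)

/-- The vertex condition: the volume elements at the vertices in `C` are killed. -/
inductive VertexConditionRel (C : Set V) : ZigzagAlgebra k Γ → ZigzagAlgebra k Γ → Prop
  | kill (c : V) (hc : c ∈ C) :
      VertexConditionRel C (ZigzagAlgebra.mk k Γ (volumeElem k Γ c)) 0

/-- The zigzag algebra of `Γ` with vertex condition for `C`. -/
def ZigzagAlgebraWith (C : Set V) : Type (max u w) := RingQuot (VertexConditionRel k Γ C)

noncomputable instance (C : Set V) : Ring (ZigzagAlgebraWith k Γ C) :=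
  inferInstanceAs (Ring (RingQuot (VertexConditionRel k Γ C)))

noncomputable instance (C : Set V) : Algebra k (ZigzagAlgebraWith k Γ C) :=
  inferInstanceAs (Algebra k (RingQuot (VertexConditionRel k Γ C)))

/-- The quotient map from the zigzag algebra. -/
noncomputable def ZigzagAlgebraWith.mk (C : Set V) :
    ZigzagAlgebra k Γ →ₐ[k] ZigzagAlgebraWith k Γ C :=
  RingQuot.mkAlgHom k (VertexConditionRel k Γ C)

/-- The vertex idempotent at `i` in the zigzag algebra with vertex condition. -/
noncomputable def ZigzagAlgebraWith.vertex (C : Set V) (i : V) : ZigzagAlgebraWith k Γ C :=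
  ZigzagAlgebraWith.mk k Γ C (ZigzagAlgebra.mk k Γ (PathAlgebra.vertex k (Q := DoubleGraph Γ) i))

end Elements

/-! ### Quasi-hereditary algebras -/

/-- A two-sided ideal `J` of `R` is hereditary if it is projective as a left module, `J J = J`
and `J Rad(R) J = 0`. -/
structure IsHereditaryIdeal {R : Type u} [Ring R] (J : Ideal R) : Prop where
  isTwoSided : J.IsTwoSided
  projective : Module.Projective R J
  mul_self : J * J = J
  mul_jacobson_mul : J * Ring.jacobson R * J = ⊥

/-- A hereditary chain `0 = J 0 ⊂ J 1 ⊂ ⋯ ⊂ J m = R` of two-sided ideals, `m ≥ 1`. -/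
structure IsHereditaryChain {R : Type u} [Ring R] {m : ℕ} (J : Fin (m + 1) → TwoSidedIdeal R) :
    Prop where
  one_le : 1 ≤ m
  strictMono : StrictMono J
  zero : J 0 = ⊥
  last : J (Fin.last m) = ⊤
  hereditary : ∀ l : Fin m, IsHereditaryIdeal
    ((TwoSidedIdeal.asIdeal (J l.succ)).map
      (Ideal.Quotient.mk (TwoSidedIdeal.asIdeal (J l.castSucc))))

/-- A finite-dimensional algebra that admits a hereditary chain. -/
def IsQuasiHereditary (k : Type w) [Field k] (R : Type u) [Ring R] [Algebra k R] : Prop :=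
  FiniteDimensional k R ∧
    ∃ (m : ℕ) (J : Fin (m + 1) → TwoSidedIdeal R), IsHereditaryChain J

/-! For connected `Γ` the algebra has a basis of vertex idempotents `e_i`, arrows `(i|j)` and volume
elements `x_i` with `i ∉ C`. Everything is computed in these coordinates (`ZigzagModel`), where the
radical consists of the elements without idempotent part and has cube zero.

The class of models is closed under deleting vertices. Factoring out the ideal generated by `e_t`,
`t ∈ T`, gives the model of the induced graph on the complement of `T`. Its vertex condition is `C`
enlarged by the neighbours of `T`, since `x_i = (i|t)(t|i)` dies (`restrict`, `ker_restrict_le`).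
Every idempotent ideal is of this form (`eq_ker_restrict_of_mul_self`), so a hereditary chain is a
successive deletion of vertex sets.

If the ideal of `T` is hereditary, then `J Rad J = 0` forces `T ⊆ C` and makes `T` independent.
Projectivity gives functionals on `J` that send `(c|j)` to an element with nonzero
`e_c`-coefficient. Hence `(l|c)(c|j) ≠ 0` for all neighbours `l` of `c`, so `c` is a leaf whose
neighbour is not in `C`, and a similar comparison shows that no two vertices of `T` share a
neighbour (`IsHereditaryIdeal.combinatorics`). Going back up the chain, a path with condition at one
end can then only be extended by one leaf at that end, which becomes the new `C`
(`exists_path_of_deletion`).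

Conversely, for a leaf `c ∈ C` with neighbour `j ∉ C` the ideal of `c` is `R e_c ⊕ R (c|j)`, two
copies of `R e_c`, and it is hereditary (`isHereditaryIdeal_ker_restrict`). Deleting the end vertex
of a path puts the condition on the next vertex, so the process continues. -/

/-! ### A model of the zigzag algebra with vertex condition -/

/-- Elements of the zigzag algebra with vertex condition in coordinates: `e` holds the coefficients
of the idempotents, `a` those of the arrows along edges, and `x` those of the volume elements. -/
@[ext] structure ZigzagModel (k : Type w) [Field k] {V : Type u} (Γ : SimpleGraph V)
    (C : Set V) : Type (max u w) where
  e : V → k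
  a : V → V → k
  x : V → k
  a_supp : ∀ i j, ¬ Γ.Adj i j → a i j = 0
  x_supp : ∀ i ∈ C, x i = 0

namespace ZigzagModel

variable {k : Type w} [Field k] {V : Type u} {Γ : SimpleGraph V} {C : Set V}

/-! ### The algebra structure in coordinates -/

section Ring

instance : Zero (ZigzagModel k Γ C) := ⟨⟨0, 0, 0, by simp, by simp⟩⟩

instance : One (ZigzagModel k Γ C) := ⟨⟨1, 0, 0, by simp, by simp⟩⟩

instance : Add (ZigzagModel k Γ C) :=
  ⟨fun p q => ⟨p.e + q.e, p.a + q.a, p.x + q.x,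
    fun i j h => by simp [p.a_supp i j h, q.a_supp i j h],
    fun i h => by simp [p.x_supp i h, q.x_supp i h]⟩⟩

instance : Neg (ZigzagModel k Γ C) :=
  ⟨fun p => ⟨-p.e, -p.a, -p.x,
    fun i j h => by simp [p.a_supp i j h],
    fun i h => by simp [p.x_supp i h]⟩⟩

open Classical in
noncomputable instance [Fintype V] : Mul (ZigzagModel k Γ C) :=
  ⟨fun p q => ⟨fun i => p.e i * q.e i, fun i j => p.e i * q.a i j + p.a i j * q.e j,
    fun i => if i ∈ C then 0 else p.e i * q.x i + p.x i * q.e i + ∑ j, p.a i j * q.a j i,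
    fun i j h => by simp [p.a_supp i j h, q.a_supp i j h],
    fun i h => by simp [h]⟩⟩

@[simp] lemma zero_e (i : V) : (0 : ZigzagModel k Γ C).e i = 0 := rfl
@[simp] lemma zero_a (i j : V) : (0 : ZigzagModel k Γ C).a i j = 0 := rfl
@[simp] lemma zero_x (i : V) : (0 : ZigzagModel k Γ C).x i = 0 := rfl
@[simp] lemma one_e (i : V) : (1 : ZigzagModel k Γ C).e i = 1 := rfl
@[simp] lemma one_a (i j : V) : (1 : ZigzagModel k Γ C).a i j = 0 := rfl
@[simp] lemma one_x (i : V) : (1 : ZigzagModel k Γ C).x i = 0 := rfl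
@[simp] lemma add_e (p q : ZigzagModel k Γ C) (i : V) : (p + q).e i = p.e i + q.e i := rfl
@[simp] lemma add_a (p q : ZigzagModel k Γ C) (i j : V) : (p + q).a i j = p.a i j + q.a i j := rfl
@[simp] lemma add_x (p q : ZigzagModel k Γ C) (i : V) : (p + q).x i = p.x i + q.x i := rfl
@[simp] lemma neg_e (p : ZigzagModel k Γ C) (i : V) : (-p).e i = -p.e i := rfl
@[simp] lemma neg_a (p : ZigzagModel k Γ C) (i j : V) : (-p).a i j = -p.a i j := rfl
@[simp] lemma neg_x (p : ZigzagModel k Γ C) (i : V) : (-p).x i = -p.x i := rfl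

/-- The support conditions settle all other coordinates, so the case `i ∈ C` in the product never
has to be opened. -/
lemma ext_of {p q : ZigzagModel k Γ C} (he : ∀ i, p.e i = q.e i)
    (ha : ∀ i j, Γ.Adj i j → p.a i j = q.a i j) (hx : ∀ i, i ∉ C → p.x i = q.x i) : p = q := by
  ext i j
  · exact he i
  · by_cases h : Γ.Adj i j
    · exact ha i j h
    · rw [p.a_supp i j h, q.a_supp i j h]
  · by_cases h : i ∈ C
    · rw [p.x_supp i h, q.x_supp i h]
    · exact hx i h

variable [Fintype V]

@[simp] lemma mul_e (p q : ZigzagModel k Γ C) (i : V) : (p * q).e i = p.e i * q.e i := rfl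

@[simp] lemma mul_a (p q : ZigzagModel k Γ C) (i j : V) :
    (p * q).a i j = p.e i * q.a i j + p.a i j * q.e j := rfl

open Classical in
lemma mul_x (p q : ZigzagModel k Γ C) (i : V) :
    (p * q).x i =
      if i ∈ C then 0 else p.e i * q.x i + p.x i * q.e i + ∑ j, p.a i j * q.a j i := rfl

lemma mul_x_of_notMem (p q : ZigzagModel k Γ C) {i : V} (hi : i ∉ C) :
    (p * q).x i = p.e i * q.x i + p.x i * q.e i + ∑ j, p.a i j * q.a j i := by
  rw [mul_x, if_neg hi]

noncomputable instance : Ring (ZigzagModel k Γ C) where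
  add_assoc p q r := by ext <;> simp [add_assoc]
  zero_add p := by ext <;> simp
  add_zero p := by ext <;> simp
  add_comm p q := by ext <;> simp [add_comm]
  neg_add_cancel p := by ext <;> simp
  nsmul := nsmulRec
  zsmul := zsmulRec
  left_distrib p q r := by
    refine ext_of (fun i => ?_) (fun i j _ => ?_) (fun i hi => ?_)
    · simp; ring
    · simp; ring
    · simp only [mul_x_of_notMem _ _ hi, add_x, add_e, add_a, mul_add, Finset.sum_add_distrib]; ring
  right_distrib p q r := by
    refine ext_of (fun i => ?_) (fun i j _ => ?_) (fun i hi => ?_)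
    · simp; ring
    · simp; ring
    · simp only [mul_x_of_notMem _ _ hi, add_x, add_e, add_a, add_mul, Finset.sum_add_distrib]; ring
  zero_mul p := by ext <;> simp [mul_x]
  mul_zero p := by ext <;> simp [mul_x]
  one_mul p := by
    refine ext_of (fun i => ?_) (fun i j _ => ?_) (fun i hi => ?_) <;>
      simp [mul_x_of_notMem, *]
  mul_one p := by
    refine ext_of (fun i => ?_) (fun i j _ => ?_) (fun i hi => ?_) <;>
      simp [mul_x_of_notMem, *]
  mul_assoc p q r := by
    refine ext_of (fun i => ?_) (fun i j _ => ?_) (fun i hi => ?_)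
    · simp; ring
    · simp; ring
    · simp only [mul_x_of_notMem _ _ hi, mul_e, mul_a, add_mul, mul_add, Finset.sum_add_distrib,
        Finset.sum_mul, Finset.mul_sum]
      -- `ring` treats the sums as atoms, so equal summands are first brought to the same
      -- bracketing.
      have h1 : ∀ j, p.e i * q.a i j * r.a j i = p.e i * (q.a i j * r.a j i) := fun j => by ring
      have h2 : ∀ j, p.a i j * q.e j * r.a j i = p.a i j * (q.e j * r.a j i) := fun j => by ring
      have h3 : ∀ j, p.a i j * q.a j i * r.e i = p.a i j * (q.a j i * r.e i) := fun j => by ring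
      simp only [h1, h2, h3]
      ring

/-- The scalars in the model. -/
noncomputable def scalar : k →+* ZigzagModel k Γ C where
  toFun c := ⟨fun _ => c, 0, 0, by simp, by simp⟩
  map_one' := rfl
  map_zero' := rfl
  map_add' c d := by ext <;> simp
  map_mul' c d := by ext <;> simp [mul_x]

@[simp] lemma scalar_e (c : k) (i : V) : (scalar c : ZigzagModel k Γ C).e i = c := rfl
@[simp] lemma scalar_a (c : k) (i j : V) : (scalar c : ZigzagModel k Γ C).a i j = 0 := rfl
@[simp] lemma scalar_x (c : k) (i : V) : (scalar c : ZigzagModel k Γ C).x i = 0 := rfl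

noncomputable instance : Algebra k (ZigzagModel k Γ C) :=
  scalar.toAlgebra' fun c p => by
    refine ext_of (fun i => ?_) (fun i j _ => ?_) (fun i hi => ?_) <;>
      simp [mul_x_of_notMem, mul_comm, *]

lemma algebraMap_eq (c : k) : algebraMap k (ZigzagModel k Γ C) c = scalar c := rfl

@[simp] lemma smul_e (c : k) (p : ZigzagModel k Γ C) (i : V) : (c • p).e i = c * p.e i := by
  rw [Algebra.smul_def, algebraMap_eq]; simp

@[simp] lemma smul_a (c : k) (p : ZigzagModel k Γ C) (i j : V) :
    (c • p).a i j = c * p.a i j := by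
  rw [Algebra.smul_def, algebraMap_eq]; simp

@[simp] lemma smul_x (c : k) (p : ZigzagModel k Γ C) (i : V) : (c • p).x i = c * p.x i := by
  by_cases hi : i ∈ C
  · rw [x_supp _ _ hi, x_supp _ _ hi, mul_zero]
  · rw [Algebra.smul_def, algebraMap_eq]; simp [mul_x_of_notMem, hi]

@[simp] lemma sub_e (p q : ZigzagModel k Γ C) (i : V) : (p - q).e i = p.e i - q.e i := by
  simp [sub_eq_add_neg]
@[simp] lemma sub_a (p q : ZigzagModel k Γ C) (i j : V) :
    (p - q).a i j = p.a i j - q.a i j := by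
  simp [sub_eq_add_neg]
@[simp] lemma sub_x (p q : ZigzagModel k Γ C) (i : V) : (p - q).x i = p.x i - q.x i := by
  simp [sub_eq_add_neg]

@[simp] lemma sum_e {ι : Type*} (s : Finset ι) (f : ι → ZigzagModel k Γ C) (i : V) :
    (∑ m ∈ s, f m).e i = ∑ m ∈ s, (f m).e i := by
  classical
  induction s using Finset.induction_on <;> simp [Finset.sum_insert, *]
@[simp] lemma sum_a {ι : Type*} (s : Finset ι) (f : ι → ZigzagModel k Γ C) (i j : V) :
    (∑ m ∈ s, f m).a i j = ∑ m ∈ s, (f m).a i j := by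
  classical
  induction s using Finset.induction_on <;> simp [Finset.sum_insert, *]
@[simp] lemma sum_x {ι : Type*} (s : Finset ι) (f : ι → ZigzagModel k Γ C) (i : V) :
    (∑ m ∈ s, f m).x i = ∑ m ∈ s, (f m).x i := by
  classical
  induction s using Finset.induction_on <;> simp [Finset.sum_insert, *]

end Ring

/-! ### Basis elements -/

open Classical in
/-- The idempotent at `i`. -/
noncomputable def E (i : V) : ZigzagModel k Γ C :=
  ⟨fun l => if l = i then 1 else 0, 0, 0, by simp, by simp⟩

open Classical in
/-- The arrow `i → j`, which is zero unless `i` and `j` are adjacent. -/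
noncomputable def A (i j : V) : ZigzagModel k Γ C :=
  ⟨0, fun l m => if l = i ∧ m = j ∧ Γ.Adj i j then 1 else 0, 0,
    fun l m h => if_neg (by rintro ⟨rfl, rfl, h'⟩; exact h h'), by simp⟩

open Classical in
/-- The volume element at `i`, which is zero if `i ∈ C`. -/
noncomputable def X (i : V) : ZigzagModel k Γ C :=
  ⟨0, 0, fun l => if l = i ∧ i ∉ C then 1 else 0, by simp,
    fun l h => if_neg (by rintro ⟨rfl, h'⟩; exact h' h)⟩

open Classical in
lemma E_e (i l : V) : (E i : ZigzagModel k Γ C).e l = if l = i then 1 else 0 := rfl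
@[simp] lemma E_e_self (i : V) : (E i : ZigzagModel k Γ C).e i = 1 := by simp [E_e]
@[simp] lemma E_a (i l m : V) : (E i : ZigzagModel k Γ C).a l m = 0 := rfl
@[simp] lemma E_x (i l : V) : (E i : ZigzagModel k Γ C).x l = 0 := rfl
@[simp] lemma A_e (i j l : V) : (A i j : ZigzagModel k Γ C).e l = 0 := rfl
open Classical in
lemma A_a (i j l m : V) :
    (A i j : ZigzagModel k Γ C).a l m = if l = i ∧ m = j ∧ Γ.Adj i j then 1 else 0 := rfl
@[simp] lemma A_x (i j l : V) : (A i j : ZigzagModel k Γ C).x l = 0 := rfl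
@[simp] lemma X_e (i l : V) : (X i : ZigzagModel k Γ C).e l = 0 := rfl
@[simp] lemma X_a (i l m : V) : (X i : ZigzagModel k Γ C).a l m = 0 := rfl
open Classical in
lemma X_x (i l : V) : (X i : ZigzagModel k Γ C).x l = if l = i ∧ i ∉ C then 1 else 0 := rfl

lemma X_eq_zero {i : V} (hi : i ∈ C) : (X i : ZigzagModel k Γ C) = 0 := by
  ext <;> simp [X_x, hi]

variable [Fintype V]

lemma eq_sum (p : ZigzagModel k Γ C) :
    p = ∑ i, p.e i • E i + ∑ i, ∑ j, p.a i j • A i j + ∑ i, p.x i • X i := by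
  classical
  refine ext_of (fun i => ?_) (fun i j h => ?_) (fun i hi => ?_)
  · simp [E_e]
  · simp only [add_a, sum_a, smul_a, E_a, X_a, A_a, mul_zero, Finset.sum_const_zero, zero_add,
      add_zero]
    rw [Finset.sum_eq_single i, Finset.sum_eq_single j]
    · simp [h]
    · intro b _ hb; simp [hb.symm]
    · simp
    · intro b _ hb; simp [hb.symm]
    · simp
  · simp only [add_x, sum_x, smul_x, E_x, X_x, A_x, mul_zero, Finset.sum_const_zero, zero_add]
    rw [Finset.sum_eq_single i]
    · simp [hi]
    · intro b _ hb; simp [hb.symm]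
    · simp

lemma sum_E : ∑ i, (E i : ZigzagModel k Γ C) = 1 := by
  classical
  ext <;> simp [E_e]

lemma E_mul_E (i : V) : (E i * E i : ZigzagModel k Γ C) = E i := by
  ext <;> simp [mul_x, E_e]

lemma E_mul_E_of_ne {i j : V} (h : i ≠ j) : (E i * E j : ZigzagModel k Γ C) = 0 := by
  ext <;> simp [mul_x, E_e]; rintro rfl; exact h.symm

lemma E_mul_A (i j : V) : (E i * A i j : ZigzagModel k Γ C) = A i j := by
  ext <;> simp [mul_x, E_e, A_a]; grind

lemma A_mul_E (i j : V) : (A i j * E j : ZigzagModel k Γ C) = A i j := by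
  ext <;> simp [mul_x, E_e, A_a]; grind

lemma E_mul_X (i : V) : (E i * X i : ZigzagModel k Γ C) = X i := by
  ext <;> simp [mul_x, E_e, X_x]; grind

lemma X_mul_E (i : V) : (X i * E i : ZigzagModel k Γ C) = X i := by
  ext <;> simp [mul_x, E_e, X_x]; grind

lemma A_mul_X (i j l : V) : (A i j * X l : ZigzagModel k Γ C) = 0 := by
  ext <;> simp [mul_x]

lemma X_mul_A (i j l : V) : (X l * A i j : ZigzagModel k Γ C) = 0 := by
  ext <;> simp [mul_x]

lemma X_mul_X (i l : V) : (X l * X i : ZigzagModel k Γ C) = 0 := by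
  ext <;> simp [mul_x]

lemma A_mul_A_of_ne {i j l : V} (h : i ≠ l) : (A i j * A j l : ZigzagModel k Γ C) = 0 := by
  classical
  refine ext_of (fun i => by simp) (fun i j _ => by simp) (fun m hm => ?_)
  simp only [mul_x_of_notMem _ _ hm, A_a]
  simp only [A_e, A_x, zero_x, mul_zero, add_zero, zero_add]
  exact Finset.sum_eq_zero fun x _ => by grind

lemma A_mul_A {i j : V} (h : Γ.Adj i j) : (A i j * A j i : ZigzagModel k Γ C) = X i := by
  classical
  refine ext_of (fun i => by simp) (fun i j _ => by simp) (fun m hm => ?_)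
  simp only [mul_x_of_notMem _ _ hm, A_a, X_x]
  by_cases hmi : m = i
  · subst hmi
    rw [Finset.sum_eq_single j] <;> simp +contextual [h, h.symm, hm]
  · simp [hmi]

end ZigzagModel

namespace ZigzagModel

variable {k : Type w} [Field k] {V : Type u} {Γ : SimpleGraph V} {C : Set V}

/-! ### Deleting vertices -/

/-- The vertex condition that remains after the vertices in `T` have been deleted: the old one,
together with the neighbours of deleted vertices. -/
def deletionCondition (Γ : SimpleGraph V) (C T : Set V) : Set ↥Tᶜ :=
  {v | v.1 ∈ C ∨ ∃ t ∈ T, Γ.Adj v t}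

lemma sum_compl_eq [Fintype V] (T : Set V) [Fintype ↥Tᶜ] (f : V → k) (hf : ∀ t ∈ T, f t = 0) :
    ∑ v : ↥Tᶜ, f v = ∑ v, f v := by
  classical
  rw [← Finset.sum_subset (Finset.subset_univ (Finset.univ.filter fun v => v ∈ Tᶜ))
    (fun t _ ht => hf t (by simpa using ht))]
  exact (Finset.sum_subtype _ (by simp) f).symm

variable [Fintype V]

lemma smul_mem_ideal {J : Ideal (ZigzagModel k Γ C)} (c : k) {p : ZigzagModel k Γ C}
    (hp : p ∈ J) : c • p ∈ J := by
  rw [Algebra.smul_def]; exact J.mul_mem_left _ hp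

variable (T : Set V) [Fintype ↥Tᶜ]

open Classical in
/-- Forgetting the coordinates that involve vertices in `T`. -/
noncomputable def restrict :
    ZigzagModel k Γ C →+* ZigzagModel k (Γ.induce Tᶜ) (deletionCondition Γ C T) where
  toFun p := ⟨fun i => p.e i, fun i j => p.a i j,
    fun i => if i ∈ deletionCondition Γ C T then 0 else p.x i,
    fun i j h => p.a_supp i j h, fun i h => if_pos h⟩
  map_one' := by ext <;> simp
  map_zero' := by ext <;> simp
  map_add' p q := by
    refine ext_of (fun i => rfl) (fun i j _ => rfl) (fun i hi => by simp [hi])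
  map_mul' p q := by
    refine ext_of (fun i => rfl) (fun i j _ => rfl) (fun i hi => ?_)
    have hC : i.1 ∉ C := fun h => hi (Or.inl h)
    rw [mul_x_of_notMem _ _ hi]
    simp only [hi, if_false, mul_x_of_notMem _ _ hC]
    congr 1
    -- Two-step paths from `i` through `T` must not contribute. They do not, because neighbours of
    -- `T` belong to the new vertex condition and `i` does not.
    refine (sum_compl_eq T (fun j => p.a i j * q.a j i) fun t ht => ?_).symm
    rw [p.a_supp i t fun h => hi (Or.inr ⟨t, ht, h⟩), zero_mul]

@[simp] lemma restrict_e (p : ZigzagModel k Γ C) (i : ↥Tᶜ) : (restrict T p).e i = p.e i := rfl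

@[simp] lemma restrict_a (p : ZigzagModel k Γ C) (i j : ↥Tᶜ) :
    (restrict T p).a i j = p.a i j := rfl

lemma restrict_x (p : ZigzagModel k Γ C) {i : ↥Tᶜ} (hi : i ∉ deletionCondition Γ C T) :
    (restrict T p).x i = p.x i := if_neg hi

lemma restrict_surjective :
    Function.Surjective (restrict T : ZigzagModel k Γ C →+* _) := by
  classical
  intro q
  refine ⟨⟨fun i => if h : i ∈ Tᶜ then q.e ⟨i, h⟩ else 0,
    fun i j => if h : i ∈ Tᶜ ∧ j ∈ Tᶜ then q.a ⟨i, h.1⟩ ⟨j, h.2⟩ else 0,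
    fun i => if h : i ∈ Tᶜ then q.x ⟨i, h⟩ else 0, fun i j h => ?_, fun i h => ?_⟩, ?_⟩
  · split_ifs with h'
    · exact q.a_supp _ _ h
    · rfl
  · split_ifs with h'
    · exact q.x_supp _ (Or.inl h)
    · rfl
  · refine ext_of (fun i => dif_pos i.2) (fun i j _ => dif_pos ⟨i.2, j.2⟩) (fun i hi => ?_)
    rw [restrict_x T _ hi]
    exact dif_pos i.2

lemma mem_ker_restrict {p : ZigzagModel k Γ C} :
    p ∈ RingHom.ker (restrict T : ZigzagModel k Γ C →+* _) ↔
      (∀ i ∉ T, p.e i = 0) ∧ (∀ i ∉ T, ∀ j ∉ T, p.a i j = 0) ∧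
      ∀ i ∉ T, i ∉ C → (∀ t ∈ T, ¬ Γ.Adj i t) → p.x i = 0 := by
  rw [RingHom.mem_ker]
  constructor
  · intro h
    refine ⟨fun i hi => ?_, fun i hi j hj => ?_, fun i hi hC hT => ?_⟩
    · exact congrArg (fun q => q.e ⟨i, hi⟩) h
    · exact congrArg (fun q => q.a ⟨i, hi⟩ ⟨j, hj⟩) h
    · have hi' : (⟨i, hi⟩ : ↥Tᶜ) ∉ deletionCondition Γ C T := by
        rintro (h' | ⟨t, ht, h'⟩)
        · exact hC h'
        · exact hT t ht h'
      rw [← restrict_x T p hi', h]; rfl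
  · rintro ⟨he, ha, hx⟩
    refine ext_of (fun i => he i i.2) (fun i j _ => ha i i.2 j j.2) (fun i hi => ?_)
    rw [restrict_x T p hi]
    exact hx i i.2 (fun h => hi (Or.inl h)) fun t ht h => hi (Or.inr ⟨t, ht, h⟩)

lemma E_mem_ker_restrict {t : V} (ht : t ∈ T) :
    (E t : ZigzagModel k Γ C) ∈ RingHom.ker (restrict T : ZigzagModel k Γ C →+* _) := by
  rw [mem_ker_restrict]
  refine ⟨fun i hi => ?_, fun _ _ _ _ => rfl, fun _ _ _ _ => rfl⟩
  rw [E_e, if_neg (by rintro rfl; exact hi ht)]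

/-- The kernel of the restriction is the two-sided ideal generated by the idempotents at the
deleted vertices. -/
lemma ker_restrict_le {J : Ideal (ZigzagModel k Γ C)} [J.IsTwoSided] (hJ : ∀ t ∈ T, E t ∈ J) :
    RingHom.ker (restrict T : ZigzagModel k Γ C →+* _) ≤ J := by
  intro p hp
  obtain ⟨he, ha, hx⟩ := (mem_ker_restrict T).1 hp
  rw [eq_sum p]
  refine J.add_mem (J.add_mem (J.sum_mem fun i _ => ?_) (J.sum_mem fun i _ =>
    J.sum_mem fun j _ => ?_)) (J.sum_mem fun i _ => ?_)
  · by_cases hi : i ∈ T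
    · exact smul_mem_ideal _ (hJ i hi)
    · rw [he i hi, zero_smul]; exact J.zero_mem
  · by_cases hi : i ∈ T
    · rw [← E_mul_A i j]
      exact smul_mem_ideal _ (J.mul_mem_right _ (hJ i hi))
    by_cases hj : j ∈ T
    · rw [← A_mul_E i j]
      exact smul_mem_ideal _ (J.mul_mem_left _ (hJ j hj))
    · rw [ha i hi j hj, zero_smul]; exact J.zero_mem
  · by_cases hi : i ∈ T
    · rw [← E_mul_X i]
      exact smul_mem_ideal _ (J.mul_mem_right _ (hJ i hi))
    by_cases hC : i ∈ C
    · rw [X_eq_zero hC, smul_zero]; exact J.zero_mem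
    by_cases hT : ∀ t ∈ T, ¬ Γ.Adj i t
    · rw [hx i hi hC hT, zero_smul]; exact J.zero_mem
    · push Not at hT
      obtain ⟨t, ht, h⟩ := hT
      -- The volume element at a neighbour of `t` factors as `(i|t) e_t (t|i)`.
      rw [← A_mul_A h, ← A_mul_E i t, mul_assoc]
      exact smul_mem_ideal _ (J.mul_mem_left _ (J.mul_mem_right _ (hJ t ht)))

end ZigzagModel

namespace ZigzagModel

variable {k : Type w} [Field k] {V : Type u} {Γ : SimpleGraph V} {C : Set V} [Fintype V]

/-! ### Ideals and the radical of the model -/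

/-- The corner at `i` is spanned by `e_i` and `x_i` with `x_i² = 0`, hence local. The element `e_i p
e_i` is invertible there, with inverse `λ⁻¹ e_i - λ⁻² μ x_i` for coefficients `λ`, `μ`. -/
lemma E_mem_of_e_ne_zero {J : Ideal (ZigzagModel k Γ C)} [J.IsTwoSided] {p : ZigzagModel k Γ C}
    (hp : p ∈ J) {i : V} (hi : p.e i ≠ 0) : E i ∈ J := by
  have key : E i = ((p.e i)⁻¹ • E i - ((p.e i)⁻¹ ^ 2 * p.x i) • X i) * p * E i := by
    classical
    refine ext_of (fun l => ?_) (fun l m h => ?_) (fun l hl => ?_)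
    · by_cases h : l = i
      · subst h; simp [hi]
      · simp [E_e, h]
    · by_cases hm : m = i
      · subst hm; simp [E_e, h.ne]
      · simp [E_e, hm]
    · simp only [mul_x_of_notMem _ _ hl]
      by_cases h : l = i
      · subst h
        simp [X_x, hl]
        field_simp
        ring
      · simp [E_e, h]
  rw [key]
  exact J.mul_mem_right _ (J.mul_mem_left _ hp)

lemma mem_jacobson_of_e_eq_zero {n : ZigzagModel k Γ C} (hn : ∀ i, n.e i = 0) :
    n ∈ Ring.jacobson (ZigzagModel k Γ C) := by
  rw [← Ideal.jacobson_bot, Ideal.mem_jacobson_iff]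
  intro y
  have h3 : y * n * (y * n) * (y * n) = 0 := by
    ext i j <;> simp [mul_x, hn]
  -- The geometric series for the inverse of `1 + y n`, which stops because products of three
  -- radical elements vanish.
  refine ⟨1 - y * n + y * n * (y * n), ?_⟩
  rw [Ideal.mem_bot, mul_assoc, add_mul, sub_mul, h3]
  noncomm_ring

lemma e_eq_zero_of_mem_jacobson {n : ZigzagModel k Γ C}
    (hn : n ∈ Ring.jacobson (ZigzagModel k Γ C)) (i : V) : n.e i = 0 := by
  by_contra h
  have hE := E_mem_of_e_ne_zero hn h
  rw [← Ideal.jacobson_bot, Ideal.mem_jacobson_iff] at hE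
  -- This yields `z (1 - e_i) = 1`, which fails in the coordinate `e_i`.
  obtain ⟨z, hz⟩ := hE (-1)
  have := congrArg (fun q => q.e i) (Ideal.mem_bot.1 hz)
  simp at this

lemma mul_induction {I J : Ideal (ZigzagModel k Γ C)} {P : ZigzagModel k Γ C → Prop}
    (hmul : ∀ p ∈ I, ∀ q ∈ J, P (p * q)) (hadd : ∀ p q, P p → P q → P (p + q))
    {p : ZigzagModel k Γ C} (hp : p ∈ I * J) : P p :=
  Submodule.smul_induction_on hp hmul hadd

/-- An idempotent two-sided ideal is generated by idempotents at vertices. -/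
lemma eq_ker_restrict_of_mul_self {J : Ideal (ZigzagModel k Γ C)} [J.IsTwoSided]
    (hJ : J * J = J) [Fintype ↥({i | E i ∈ J} : Set V)ᶜ] :
    J = RingHom.ker (restrict {i | E i ∈ J} : ZigzagModel k Γ C →+* _) := by
  refine le_antisymm ?_ (ker_restrict_le _ fun t ht => ht)
  set T : Set V := {i | E i ∈ J}
  -- The image of `J` lies in the radical. Using `J = J J` twice then pushes it first out of the
  -- arrow coordinates and finally out of the volume coordinates.
  have he : ∀ p ∈ J, ∀ i, (restrict T p).e i = 0 := fun p hp i => by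
    by_contra h
    exact i.2 (E_mem_of_e_ne_zero hp h)
  have ha : ∀ p ∈ J, ∀ i j, (restrict T p).a i j = 0 := fun p hp => by
    rw [← hJ] at hp
    refine mul_induction (P := fun p => ∀ i j, (restrict T p).a i j = 0)
      (fun p hp q hq i j => ?_) (fun p q hp hq i j => ?_) hp
    · rw [map_mul, mul_a, he p hp, he q hq, zero_mul, mul_zero, add_zero]
    · rw [map_add, add_a, hp, hq, add_zero]
  intro p hp
  rw [← hJ] at hp
  refine mul_induction (P := (· ∈ RingHom.ker (restrict T))) (fun p hp q hq => ?_)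
    (fun p q hp hq => Ideal.add_mem _ hp hq) hp
  rw [RingHom.mem_ker, map_mul]
  refine ext_of (fun i => by simp [he p hp]) (fun i j _ => by simp [he p hp, he q hq])
    fun i hi => ?_
  rw [mul_x_of_notMem _ _ hi]
  simp [he p hp, he q hq, ha p hp]

/-! ### Hereditary ideals of the model -/

/-- By the dual basis lemma `(c|j)` is a combination of elements `p ∈ J` with coefficients given by
functionals. As `p` has no `e_j`-part, the coordinate `(c|j)` of a summand is the `e_c`-coordinate
of its coefficient times that of `p`, so some `e_c`-coordinate is nonzero. -/
lemma exists_functional {J : Ideal (ZigzagModel k Γ C)} [Module.Projective (ZigzagModel k Γ C) J]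
    {c j : V} (hcj : Γ.Adj c j) (hj : ∀ p ∈ J, p.e j = 0) (hA : A c j ∈ J) :
    ∃ f : J →ₗ[ZigzagModel k Γ C] ZigzagModel k Γ C, (f ⟨A c j, hA⟩).e c ≠ 0 := by
  classical
  obtain ⟨s, hs⟩ := Module.projective_def.1 ‹Module.Projective (ZigzagModel k Γ C) J›
  by_contra! h
  have h0 : ∀ p : J, (s ⟨A c j, hA⟩ p).e c = 0 := fun p => h (Finsupp.lapply p ∘ₗ s)
  have h1 := congrArg (fun q : J => q.1.a c j) (hs ⟨A c j, hA⟩)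
  simp only [Finsupp.linearCombination_apply, Finsupp.sum, id, Submodule.coe_sum, sum_a,
    Submodule.coe_smul, smul_eq_mul, mul_a, h0, zero_mul, zero_add] at h1
  rw [Finset.sum_eq_zero fun p _ => by rw [hj p p.2, mul_zero]] at h1
  simp [A_a, hcj] at h1

/-- The combinatorial consequences of the existence of a hereditary ideal. -/
theorem _root_.IsHereditaryIdeal.combinatorics {J : Ideal (ZigzagModel k Γ C)}
    (hJ : IsHereditaryIdeal J) :
    (∀ c, E c ∈ J → c ∈ C) ∧ (∀ c d, E c ∈ J → E d ∈ J → ¬ Γ.Adj c d) ∧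
    (∀ c j, E c ∈ J → Γ.Adj c j → j ∉ C ∧ ∀ l, Γ.Adj c l → l = j) ∧
    ∀ c d j, E c ∈ J → E d ∈ J → Γ.Adj c j → Γ.Adj d j → c = d := by
  classical
  have := hJ.isTwoSided
  have := hJ.projective
  have hrad : ∀ c d, E c ∈ J → E d ∈ J → ∀ n : ZigzagModel k Γ C, (∀ i, n.e i = 0) →
      E c * n * E d = 0 := fun c d hc hd n hn => by
    rw [← Ideal.mem_bot, ← hJ.mul_jacobson_mul]
    exact Ideal.mul_mem_mul (Ideal.mul_mem_mul hc (mem_jacobson_of_e_eq_zero hn)) hd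
  have hind : ∀ c d, E c ∈ J → E d ∈ J → ¬ Γ.Adj c d := fun c d hc hd h => by
    have := congrArg (fun p => p.a c d) (hrad c d hc hd (A c d) fun _ => rfl)
    simp [A_a, h] at this
  have hA : ∀ c j, E c ∈ J → A c j ∈ J := fun c j hc => by
    rw [← E_mul_A]; exact J.mul_mem_right _ hc
  have hfun : ∀ c j (hc : E c ∈ J), Γ.Adj c j →
      ∃ f : J →ₗ[ZigzagModel k Γ C] ZigzagModel k Γ C, (f ⟨A c j, hA c j hc⟩).e c ≠ 0 :=
    fun c j hc h => exists_functional h (fun p hp => by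
      by_contra hp'
      exact hind c j hc (E_mem_of_e_ne_zero hp hp') h) _
  refine ⟨fun c hc => ?_, hind, fun c j hc hcj => ?_, fun c d j hc hd hcj hdj => ?_⟩
  · by_contra h
    have := hrad c c hc hc (X c) fun _ => rfl
    rw [E_mul_X, X_mul_E] at this
    simpa [X_x, h] using congrArg (fun p => p.x c) this
  -- If the product vanished, linearity of `f` would give `(l|c) f((c|j)) = 0`, but the coordinate
  -- `(l|c)` of this is the nonzero `e_c`-coordinate of `f((c|j))`.
  · have hne : ∀ l, Γ.Adj c l → (A l c * A c j : ZigzagModel k Γ C) ≠ 0 := fun l hl h => by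
      obtain ⟨f, hf⟩ := hfun c j hc hcj
      have h1 : (A l c : ZigzagModel k Γ C) • (⟨A c j, hA c j hc⟩ : J) = 0 := Subtype.ext h
      have h2 := congrArg f h1
      rw [map_smul, map_zero, smul_eq_mul] at h2
      have := congrArg (fun p => p.a l c) h2
      simp [A_a, hl.symm, hf] at this
    have hl : ∀ l, Γ.Adj c l → l = j := fun l hl => by
      by_contra h
      exact hne l hl (A_mul_A_of_ne h)
    refine ⟨fun h => hne j hcj ?_, hl⟩
    rw [A_mul_A hcj.symm, X_eq_zero h]
  · by_contra hcd
    obtain ⟨f, hf⟩ := hfun c j hc hcj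
    -- Both sides equal `x_j`. Applying `f`, the left side has a nonzero coordinate `(j|c)`, while
    -- the right side, a multiple of `(j|d)`, has none.
    have h1 : (A j c : ZigzagModel k Γ C) • (⟨A c j, hA c j hc⟩ : J) =
        (A j d : ZigzagModel k Γ C) • (⟨A d j, hA d j hd⟩ : J) :=
      Subtype.ext ((A_mul_A hcj.symm).trans (A_mul_A hdj.symm).symm)
    have h2 := congrArg f h1
    rw [map_smul, map_smul, smul_eq_mul, smul_eq_mul] at h2
    have := congrArg (fun p => p.a j c) h2
    simp [A_a, hcj.symm, hf, hcd] at this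

/-- Deleting a vertex `c ∈ C` of degree at most one whose neighbours are not in `C` amounts to
factoring out a hereditary ideal. -/
theorem isHereditaryIdeal_ker_restrict {c : V} (hc : c ∈ C) (hC : ∀ j, Γ.Adj c j → j ∉ C)
    (huniq : ∀ i j, Γ.Adj c i → Γ.Adj c j → i = j) [Fintype ↥({c} : Set V)ᶜ] :
    IsHereditaryIdeal (RingHom.ker (restrict {c} : ZigzagModel k Γ C →+* _)) := by
  classical
  set K := RingHom.ker (restrict {c} : ZigzagModel k Γ C →+* _)
  have hE : E c ∈ K := E_mem_ker_restrict {c} rfl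
  have hA : ∀ j, A c j ∈ K := fun j => by rw [← E_mul_A]; exact K.mul_mem_right _ hE
  have he : ∀ p ∈ K, ∀ i, i ≠ c → p.e i = 0 := fun p hp i hi =>
    ((mem_ker_restrict {c}).1 hp).1 i hi
  have ha : ∀ p ∈ K, ∀ i j, i ≠ c → j ≠ c → p.a i j = 0 := fun p hp i j hi hj =>
    ((mem_ker_restrict {c}).1 hp).2.1 i hi j hj
  have hx : ∀ p ∈ K, ∀ i, ¬ Γ.Adj i c → p.x i = 0 := fun p hp i hi => by
    by_cases hiC : i ∈ C
    · exact p.x_supp i hiC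
    · exact ((mem_ker_restrict {c}).1 hp).2.2 i (fun h => hiC (h ▸ hc)) hiC
        (by rintro t rfl; exact hi)
  refine ⟨inferInstance, ?_, ?_, ?_⟩
  -- For `j` adjacent to `c`, `g j` reads off the coordinates of `(c|j)` and `x_j = (j|c)(c|j)` and
  -- returns the combination of `e_c` and `(j|c)` whose right multiple by `(c|j)` restores them. For
  -- all other `j` it is zero.
  · let g (j : V) : K →ₗ[ZigzagModel k Γ C] ZigzagModel k Γ C :=
      { toFun := fun y => ⟨fun i => if i = c then y.1.a c j else 0,
          fun l m => if l = j ∧ m = c ∧ Γ.Adj j c then y.1.x j else 0, 0,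
          fun l m h => if_neg (by rintro ⟨rfl, rfl, h'⟩; exact h h'), fun _ _ => rfl⟩
        map_add' := fun y z => by
          ext <;> simp [ite_add_ite]
        -- Linearity uses both hypotheses: `j ∉ C`, so that `x_j` really records `(j|c)(c|j)`, and
        -- uniqueness of the neighbour, so that arrows `(l|c)` with `l ≠ j` create no further terms.
        map_smul' := fun r y => by
          have hyj : ∀ j, j ≠ c → y.1.e j = 0 := he y.1 y.2
          have hya := ha y.1 y.2
          refine ext_of (fun i => ?_) (fun l m h => ?_) (fun i hi => ?_)
          · have h0 : r.a c j * y.1.e j = 0 := by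
              by_cases h : j = c
              · rw [r.a_supp c j (by simp [h]), zero_mul]
              · rw [hyj j h, mul_zero]
            by_cases hi : i = c <;> simp [h0, hi]
          · simp only [Submodule.coe_smul, smul_eq_mul, RingHom.id_apply, mul_a]
            by_cases hm : m = c
            · subst hm
              by_cases hl : l = j
              · subst hl
                have hsum : ∑ n, r.a l n * y.1.a n l = r.a l m * y.1.a m l :=
                  Finset.sum_eq_single m (fun n _ hn => by rw [hya n l hn h.ne, mul_zero])
                    (by simp)
                simp [h, mul_x_of_notMem _ _ (hC l h.symm), hsum, hyj l h.ne]
              · have hj : ¬ Γ.Adj m j := fun hj => hl (huniq l j h.symm hj)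
                simp [hl, y.1.a_supp m j hj]
            · simp [hm]
          · have hic : i ≠ c := by rintro rfl; exact hi hc
            simp [mul_x_of_notMem _ _ hi, hic] }
    let i : K →ₗ[ZigzagModel k Γ C] ZigzagModel k Γ C × (V → ZigzagModel k Γ C) :=
      ((LinearMap.toSpanSingleton _ _ (E c)).comp K.subtype).prod (LinearMap.pi g)
    let s : ZigzagModel k Γ C × (V → ZigzagModel k Γ C) →ₗ[ZigzagModel k Γ C] K :=
      (LinearMap.toSpanSingleton _ _ ⟨E c, hE⟩).coprod
        (Fintype.linearCombination _ fun j => ⟨A c j, hA j⟩)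
    -- `K` is a retract of a free module: `s` maps the free generators to `e_c` and the `(c|j)`, and
    -- `i` splits it.
    refine Module.Projective.of_split i s (LinearMap.ext fun y => Subtype.ext ?_)
    have hsi : ((s (i y) : K) : ZigzagModel k Γ C) = y.1 * E c * E c + ∑ j, g j y * A c j := by
      simp [s, i, Fintype.linearCombination_apply]
    rw [LinearMap.comp_apply, hsi, mul_assoc, E_mul_E, LinearMap.id_apply]
    refine ext_of (fun l => ?_) (fun l m h => ?_) (fun l hl => ?_)
    · by_cases hl : l = c
      · simp [hl]
      · simp [E_e, hl, he y.1 y.2 l hl]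
    · simp only [add_a, sum_a, mul_a, A_e, mul_zero, add_zero, E_a, zero_add]
      by_cases hl : l = c
      · subst hl
        rw [Finset.sum_eq_single m]
        · simp [A_a, h, g, E_e, h.ne']
        · intro b _ hb
          simp [A_a, hb.symm]
        · simp
      · rw [Finset.sum_eq_zero fun b _ => by simp [g, hl]]
        by_cases hm : m = c
        · simp [hm]
        · simp [E_e, hm, ha y.1 y.2 l m hl hm]
    · have hlc : l ≠ c := by rintro rfl; exact hl hc
      simp only [add_x, sum_x, mul_x_of_notMem _ _ hl, A_e, A_x, E_e, E_x, E_a, if_neg hlc,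
        mul_zero, add_zero, zero_add, Finset.sum_const_zero]
      by_cases h : Γ.Adj l c
      · rw [Finset.sum_eq_single l, Finset.sum_eq_single c]
        · simp [g, A_a, h, h.symm]
        · intro b _ hb; simp [A_a, hb]
        · simp
        · intro b _ hb
          exact Finset.sum_eq_zero fun m _ => by simp [A_a, hb.symm]
        · simp
      · rw [hx y.1 y.2 l h]
        refine Finset.sum_eq_zero fun b _ => Finset.sum_eq_zero fun m _ => ?_
        by_cases hmc : m = c
        · rw [hmc, (g b y).a_supp l c h, zero_mul]
        · simp [A_a, hmc]
  · refine le_antisymm Ideal.mul_le_left (ker_restrict_le {c} ?_)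
    rintro t rfl
    rw [← E_mul_E]
    exact Ideal.mul_mem_mul hE hE
  · rw [eq_bot_iff]
    intro p hp
    refine mul_induction (P := (· ∈ (⊥ : Ideal _))) (fun p hp q hq => ?_)
      (fun p q => Ideal.add_mem _) hp
    -- Elements of `K Rad` have no idempotent part, and their arrows all start at `c`. Multiplying
    -- by `q ∈ K`, whose only idempotent coordinate is at `c`, could leave only `x_c`, which is
    -- zero.
    have h1 := mul_induction (P := fun p => (∀ i, p.e i = 0) ∧ ∀ i j, i ≠ c → p.a i j = 0)
      (fun p hp r hr => ⟨fun i => ?_, fun i j hi => ?_⟩)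
      (fun p r hp hr => ⟨fun i => ?_, fun i j hi => ?_⟩) hp
    · refine ext_of (fun i => ?_) (fun i j h => ?_) (fun i hi => ?_)
      · simp [h1.1]
      · rw [mul_a, h1.1, zero_mul, zero_add]
        by_cases hic : i = c
        · rw [he q hq j (by rintro rfl; exact h.ne hic), mul_zero]; rfl
        · rw [h1.2 i j hic, zero_mul]; rfl
      · have hic : i ≠ c := by rintro rfl; exact hi hc
        simp [mul_x_of_notMem _ _ hi, h1.1, h1.2 i _ hic, he q hq i hic]
    · rw [mul_e, e_eq_zero_of_mem_jacobson hr, mul_zero]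
    · rw [mul_a, he p hp i hi, e_eq_zero_of_mem_jacobson hr, zero_mul, mul_zero, add_zero]
    · rw [add_e, hp.1, hr.1, add_zero]
    · rw [add_a, hp.2 i j hi, hr.2 i j hi, add_zero]

end ZigzagModel

/-! ### Transport of hereditary ideals -/

section Transport

variable {R S : Type u} [Ring R] [Ring S]

lemma Ideal.map_mul_of_surjective {f : R →+* S} (hf : Function.Surjective f) (I J : Ideal R) :
    (I * J).map f = I.map f * J.map f := by
  refine le_antisymm (Ideal.map_le_iff_le_comap.2 fun x hx => ?_) fun y hy => ?_
  · refine Submodule.smul_induction_on (p := (· ∈ (I.map f * J.map f).comap f)) hx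
      (fun a ha b hb => ?_) (fun a b => Ideal.add_mem _)
    rw [Ideal.mem_comap, smul_eq_mul, map_mul]
    exact Ideal.mul_mem_mul (Ideal.mem_map_of_mem f ha) (Ideal.mem_map_of_mem f hb)
  · refine Submodule.smul_induction_on (p := (· ∈ (I * J).map f)) hy
      (fun a' ha' b' hb' => ?_) (fun a b => Ideal.add_mem _)
    obtain ⟨a, ha, rfl⟩ := (Ideal.mem_map_iff_of_surjective f hf).1 ha'
    obtain ⟨b, hb, rfl⟩ := (Ideal.mem_map_iff_of_surjective f hf).1 hb'
    rw [smul_eq_mul, ← map_mul]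
    exact Ideal.mem_map_of_mem f (Ideal.mul_mem_mul ha hb)

lemma IsHereditaryIdeal.map_equiv (e : R ≃+* S) {J : Ideal R} (hJ : IsHereditaryIdeal J) :
    IsHereditaryIdeal (J.map (e : R →+* S)) := by
  have hs : Function.Surjective (e : R →+* S) := e.surjective
  have := hJ.isTwoSided
  have := hJ.projective
  refine ⟨?_, ?_, ?_, ?_⟩
  · have : RingHomSurjective (e : R →+* S) := ⟨hs⟩
    infer_instance
  · have := RingHomInvPair.of_ringEquiv e
    have : RingHomInvPair (e.symm : S →+* R) (e : R →+* S) := RingHomInvPair.of_ringEquiv e.symm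
    let φ : J ≃ₛₗ[(e : R →+* S)] J.map (e : R →+* S) :=
      { toFun := fun x => ⟨e x, Ideal.mem_map_of_mem _ x.2⟩
        invFun := fun y => ⟨e.symm y, by
          obtain ⟨x, hx, h⟩ := (Ideal.mem_map_iff_of_surjective _ hs).1 y.2
          rw [← h]; simpa using hx⟩
        left_inv := fun x => by simp
        right_inv := fun x => by simp
        map_add' := fun x y => Subtype.ext (map_add e _ _)
        map_smul' := fun r x => Subtype.ext (map_mul e _ _) }
    exact Module.Projective.of_equiv φ
  · rw [← Ideal.map_mul_of_surjective hs, hJ.mul_self]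
  · rw [← Ideal.jacobson_bot,
      show (⊥ : Ideal S) = Ideal.map (e : R →+* S) ⊥ from Ideal.map_bot.symm,
      ← Ideal.map_jacobson_of_bijective (f := (e : R →+* S)) e.bijective, Ideal.jacobson_bot,
      ← Ideal.map_mul_of_surjective hs, ← Ideal.map_mul_of_surjective hs, hJ.mul_jacobson_mul]

/-- This replaces the quotient ring in the definition of a hereditary chain by a concrete model of
the same quotient. -/
lemma isHereditaryIdeal_map_iff {f : R →+* S} (hf : Function.Surjective f) {I : Ideal R}
    [I.IsTwoSided] (hI : RingHom.ker f = I) (J : Ideal R) :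
    IsHereditaryIdeal (J.map (Ideal.Quotient.mk I)) ↔ IsHereditaryIdeal (J.map f) := by
  subst hI
  let e := RingHom.quotientKerEquivOfSurjective hf
  have h1 : (e : _ →+* S).comp (Ideal.Quotient.mk (RingHom.ker f)) = f := RingHom.ext fun x => rfl
  have h2 : (J.map (Ideal.Quotient.mk (RingHom.ker f))).map (e : _ →+* S) = J.map f := by
    rw [Ideal.map_map, h1]
  refine ⟨fun h => h2 ▸ h.map_equiv e, fun h => ?_⟩
  have h3 := h.map_equiv e.symm
  rw [← h2, Ideal.map_map] at h3
  simpa using h3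

end Transport

namespace ZigzagModel

variable {k : Type w} [Field k] {V : Type u} {Γ : SimpleGraph V} {C : Set V} [Fintype V]

/-! ### Comparison with the presentation -/

section Lift

variable (k Γ C)

open Classical in
/-- The coefficient of the volume element in the first loop. -/
noncomputable def loopCoeff : k := if (2 : k) = 0 then 1 else 2⁻¹

/-- The images of the generators of the path algebra in the model. -/
noncomputable def genImage : PathGen (DoubleGraph Γ) → ZigzagModel k Γ C
  | .vertex i => E (V := V) i
  | .arrow (i := i) (j := j) (.edge _) => A (V := V) i j
  | .arrow (.loopS i) => loopCoeff k • X (V := V) i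
  | .arrow (.loopT i) => -loopCoeff k • X (V := V) i

lemma genImage_arrow {i j : V} (a : DoubleArrow Γ i j) :
    (a.degree = 1 ∧ Γ.Adj i j ∧
      genImage k Γ C (PathGen.arrow (Q := DoubleGraph Γ) (i := i) (j := j) a) = A i j) ∨
    (a.degree = 2 ∧ i = j ∧ ∃ c : k,
      genImage k Γ C (PathGen.arrow (Q := DoubleGraph Γ) (i := i) (j := j) a) = c • X i) := by
  cases a with
  | edge h => exact Or.inl ⟨rfl, h, rfl⟩
  | loopS => exact Or.inr ⟨rfl, rfl, _, rfl⟩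
  | loopT => exact Or.inr ⟨rfl, rfl, _, rfl⟩

/-- The map from the path algebra to the model. -/
noncomputable def ofPathAlgebra : DoublePathAlgebra k Γ →ₐ[k] ZigzagModel k Γ C :=
  RingQuot.liftAlgHom k ⟨FreeAlgebra.lift k (genImage k Γ C), by
    intro p q h
    induction h with
    | idem i => simpa [genImage] using E_mul_E (V := V) i
    | orth i j h => simpa [genImage] using E_mul_E_of_ne (V := V) h
    | one =>
      rw [map_sum, map_one]
      simp only [FreeAlgebra.lift_ι_apply, genImage]
      exact sum_E (V := V)
    | @source i j a =>
      rw [map_mul]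
      simp only [FreeAlgebra.lift_ι_apply]
      rcases genImage_arrow k Γ C a with ⟨_, _, h⟩ | ⟨_, rfl, c, h⟩
      · exact h ▸ E_mul_A (V := V) i j
      · rw [h, mul_smul_comm]
        exact congrArg _ (E_mul_X (V := V) i)
    | @target i j a =>
      rw [map_mul]
      simp only [FreeAlgebra.lift_ι_apply]
      rcases genImage_arrow k Γ C a with ⟨_, _, h⟩ | ⟨_, rfl, c, h⟩
      · exact h ▸ A_mul_E (V := V) i j
      · rw [h, smul_mul_assoc]
        exact congrArg _ (X_mul_E (V := V) i)⟩

lemma ofPathAlgebra_mk (g : PathGen (DoubleGraph Γ)) :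
    ofPathAlgebra k Γ C (PathAlgebra.mk k (FreeAlgebra.ι k g)) = genImage k Γ C g := by
  refine (RingQuot.liftAlgHom_mkAlgHom_apply k _ _ _).trans ?_
  simp

lemma ofPathAlgebra_vertex (i : V) :
    ofPathAlgebra k Γ C (PathAlgebra.vertex k (Q := DoubleGraph Γ) i) = E i :=
  ofPathAlgebra_mk k Γ C _

lemma ofPathAlgebra_edge {i j : V} (h : Γ.Adj i j) :
    ofPathAlgebra k Γ C (edgeElem k Γ h) = A i j :=
  ofPathAlgebra_mk k Γ C _

lemma ofPathAlgebra_loopS (i : V) :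
    ofPathAlgebra k Γ C (loopSElem k Γ i) = loopCoeff k • X i :=
  ofPathAlgebra_mk k Γ C _

lemma ofPathAlgebra_loopT (i : V) :
    ofPathAlgebra k Γ C (loopTElem k Γ i) = -loopCoeff k • X i :=
  ofPathAlgebra_mk k Γ C _

lemma ofPathAlgebra_volume (i : V) : ofPathAlgebra k Γ C (volumeElem k Γ i) = X i := by
  unfold volumeElem
  split_ifs with h
  · rw [ofPathAlgebra_loopS, loopCoeff, if_pos h, one_smul]
  · rw [map_sub, ofPathAlgebra_loopS, ofPathAlgebra_loopT, ← sub_smul, loopCoeff, if_neg h]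
    rw [show (2⁻¹ - -2⁻¹ : k) = 1 by field_simp; norm_num, one_smul]

variable {k Γ C} in
/-- The shape of the image in the model of a path of degree `d` from `i` to `j` that visits the
vertices in `S`. -/
def IsPathImage (i j : V) (d : ℕ) (S : V → Prop) (y : ZigzagModel k Γ C) : Prop :=
  (d = 0 ∧ y = E i ∧ i = j ∧ ∀ v, S v → v = i) ∨
  (d = 1 ∧ y = A i j ∧ ∀ v, S v → v = i ∨ v = j) ∨
  (d = 2 ∧ i = j ∧ ∃ (c : k) (l : V), y = c • X i ∧ ∀ v, S v → v = i ∨ v = l) ∨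
  y = 0

variable {k Γ C} in
-- A nonzero image has degree at most two and meets at most two vertices. Carrying both bounds along
-- a path verifies the three-vertex relation and the degree-three relation at once.
lemma IsPathImage.cons {i j l : V} {d : ℕ} {S : V → Prop} {y : ZigzagModel k Γ C}
    (h : IsPathImage i j d S y) (a : DoubleArrow Γ j l) :
    IsPathImage i l (d + a.degree) (fun v => S v ∨ v = l)
      (y * genImage k Γ C (PathGen.arrow (Q := DoubleGraph Γ) (i := j) (j := l) a)) := by
  have ha := genImage_arrow k Γ C a
  rcases h with ⟨rfl, rfl, rfl, hv⟩ | ⟨rfl, rfl, hv⟩ | ⟨rfl, rfl, c, m, rfl, hv⟩ | rfl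
  · rcases ha with ⟨had, _, ha⟩ | ⟨had, rfl, c, ha⟩
    · refine Or.inr (Or.inl ⟨by rw [had], by rw [ha, E_mul_A], ?_⟩)
      rintro v (h | rfl)
      · exact Or.inl (hv v h)
      · exact Or.inr rfl
    · refine Or.inr (Or.inr (Or.inl ⟨by rw [had], rfl, c, i,
        by rw [ha, mul_smul_comm, E_mul_X], ?_⟩))
      rintro v (h | rfl)
      · exact Or.inl (hv v h)
      · exact Or.inl rfl
  · rcases ha with ⟨had, hadj, ha⟩ | ⟨had, rfl, c, ha⟩
    · by_cases hil : i = l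
      · subst hil
        refine Or.inr (Or.inr (Or.inl ⟨by rw [had], rfl, 1, j,
          by rw [ha, A_mul_A hadj.symm, one_smul], ?_⟩))
        rintro v (h | rfl)
        · exact hv v h
        · exact Or.inl rfl
      · exact Or.inr (Or.inr (Or.inr (by rw [ha, A_mul_A_of_ne hil])))
    · exact Or.inr (Or.inr (Or.inr (by rw [ha, mul_smul_comm, A_mul_X, smul_zero])))
  · refine Or.inr (Or.inr (Or.inr ?_))
    rcases ha with ⟨_, _, ha⟩ | ⟨_, rfl, d, ha⟩
    · rw [ha, smul_mul_assoc, X_mul_A, smul_zero]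
    · rw [ha, mul_smul_comm, smul_mul_assoc, X_mul_X, smul_zero, smul_zero]
  · exact Or.inr (Or.inr (Or.inr (zero_mul _)))

lemma ofPathAlgebra_path {i j : DoubleGraph Γ} (p : Quiver.Path i j) :
    IsPathImage (V := V) i j (DoubleGraph.pathDegree p) (fun v => v ∈ p.vertices)
      (ofPathAlgebra k Γ C (PathAlgebra.ofPath k p)) := by
  induction p with
  | nil => exact Or.inl ⟨rfl, ofPathAlgebra_vertex k Γ C _, rfl, fun v hv => List.mem_singleton.1 hv⟩
  | @cons j l p a ih =>
    have hmul : ofPathAlgebra k Γ C (PathAlgebra.ofPath k (p.cons a)) =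
        ofPathAlgebra k Γ C (PathAlgebra.ofPath k p) * genImage k Γ C (PathGen.arrow a) :=
      (map_mul _ _ _).trans (congrArg _ (ofPathAlgebra_mk k Γ C _))
    have hS : (fun v => v ∈ (p.cons a).vertices) = fun v => v ∈ p.vertices ∨ v = l :=
      funext fun v => propext (Quiver.Path.mem_vertices_cons p a)
    rw [hmul]
    exact hS ▸ ih.cons a

/-- The map from the zigzag algebra to the model. -/
noncomputable def ofZigzagAlgebra : ZigzagAlgebra k Γ →ₐ[k] ZigzagModel k Γ C :=
  RingQuot.liftAlgHom k ⟨ofPathAlgebra k Γ C, by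
    intro p q h
    induction h with
    | @bounded i j p hp =>
      obtain ⟨a, ha, b, hb, c, hc, hab, hac, hbc⟩ := hp
      rw [map_zero]
      rcases ofPathAlgebra_path k Γ C p with ⟨_, _, _, hv⟩ | ⟨_, _, hv⟩ | ⟨_, _, _, l, _, hv⟩ | hp
      · exact absurd ((hv a ha).trans (hv b hb).symm) hab
      · have := hv a ha; have := hv b hb; have := hv c hc; grind
      · have := hv a ha; have := hv b hb; have := hv c hc; grind
      · exact hp
    | loops_comm i =>
      rw [map_mul, map_mul, ofPathAlgebra_loopS, ofPathAlgebra_loopT]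
      simp [X_mul_X]
    | loops_add i =>
      rw [map_add, ofPathAlgebra_loopS, ofPathAlgebra_loopT, map_zero, neg_smul, add_neg_cancel]
    | loops_mul i =>
      rw [map_mul, ofPathAlgebra_loopS, ofPathAlgebra_loopT]
      simp [X_mul_X]
    | zigzag h =>
      rw [map_mul, ofPathAlgebra_edge, ofPathAlgebra_edge, ofPathAlgebra_volume, A_mul_A h]
    | two_vertices hV p hp =>
      rw [map_zero]
      rcases ofPathAlgebra_path k Γ C p with ⟨h, _⟩ | ⟨h, _⟩ | ⟨h, _⟩ | h
      · omega
      · omega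
      · omega
      · exact h⟩

lemma ofZigzagAlgebra_mk (p : DoublePathAlgebra k Γ) :
    ofZigzagAlgebra k Γ C (ZigzagAlgebra.mk k Γ p) = ofPathAlgebra k Γ C p :=
  RingQuot.liftAlgHom_mkAlgHom_apply k _ _ _

/-- The map from the zigzag algebra with vertex condition to the model. -/
noncomputable def ofZigzagAlgebraWith : ZigzagAlgebraWith k Γ C →ₐ[k] ZigzagModel k Γ C :=
  RingQuot.liftAlgHom k ⟨ofZigzagAlgebra k Γ C, by
    intro p q h
    induction h with
    | kill c hc => rw [ofZigzagAlgebra_mk, ofPathAlgebra_volume, X_eq_zero hc, map_zero]⟩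

lemma ofZigzagAlgebraWith_mk (p : DoublePathAlgebra k Γ) :
    ofZigzagAlgebraWith k Γ C (ZigzagAlgebraWith.mk k Γ C (ZigzagAlgebra.mk k Γ p)) =
      ofPathAlgebra k Γ C p :=
  (RingQuot.liftAlgHom_mkAlgHom_apply k _ _ _).trans (ofZigzagAlgebra_mk k Γ C p)

lemma ofZigzagAlgebraWith_vertex (i : V) :
    ofZigzagAlgebraWith k Γ C (ZigzagAlgebraWith.vertex k Γ C i) = E i :=
  (ofZigzagAlgebraWith_mk k Γ C _).trans (ofPathAlgebra_vertex k Γ C i)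

end Lift

end ZigzagModel

/-! ### Relations in the zigzag algebra with vertex condition -/

namespace ZigzagAlgebraWith

variable (k : Type w) [Field k] {V : Type u} [Fintype V] (Γ : SimpleGraph V) (C : Set V)

/-- The quotient map from the path algebra of the double graph. -/
noncomputable def ofDouble : DoublePathAlgebra k Γ →ₐ[k] ZigzagAlgebraWith k Γ C :=
  (ZigzagAlgebraWith.mk k Γ C).comp (ZigzagAlgebra.mk k Γ)

open Classical in
/-- The arrow `i → j` in the zigzag algebra, zero unless `i` and `j` are adjacent. -/
noncomputable def edge (i j : V) : ZigzagAlgebraWith k Γ C :=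
  if h : Γ.Adj i j then ofDouble k Γ C (edgeElem k Γ h) else 0

/-- The volume element at `i` in the zigzag algebra. -/
noncomputable def volume (i : V) : ZigzagAlgebraWith k Γ C :=
  ofDouble k Γ C (volumeElem k Γ i)

variable {k Γ}

lemma _root_.PathAlgebra.mk_rel {p q : FreeAlgebra k (PathGen (DoubleGraph Γ))}
    (h : PathRel k (DoubleGraph Γ) p q) : PathAlgebra.mk k p = PathAlgebra.mk k q :=
  RingQuot.mkAlgHom_rel k h

lemma ofDouble_rel {p q : DoublePathAlgebra k Γ} (h : ZigzagRel k Γ p q) :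
    ofDouble k Γ C p = ofDouble k Γ C q :=
  congrArg (ZigzagAlgebraWith.mk k Γ C) (RingQuot.mkAlgHom_rel k h)

lemma edge_eq {i j : V} (h : Γ.Adj i j) : edge k Γ C i j = ofDouble k Γ C (edgeElem k Γ h) :=
  dif_pos h

lemma edge_eq_zero {i j : V} (h : ¬ Γ.Adj i j) : edge k Γ C i j = 0 := dif_neg h

lemma volume_eq_zero {i : V} (h : i ∈ C) : volume k Γ C i = 0 :=
  (RingQuot.mkAlgHom_rel k (VertexConditionRel.kill (k := k) (Γ := Γ) i h)).trans (map_zero _)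

lemma sum_vertex : ∑ i, vertex k Γ C i = 1 := by
  have h := congrArg (ofDouble k Γ C)
    (PathAlgebra.mk_rel (PathRel.one (k := k) (Q := DoubleGraph Γ)))
  rw [map_sum, map_sum, map_one, map_one] at h
  exact h

lemma vertex_mul_self (i : V) : vertex k Γ C i * vertex k Γ C i = vertex k Γ C i := by
  have h := congrArg (ofDouble k Γ C)
    (PathAlgebra.mk_rel (PathRel.idem (k := k) (Q := DoubleGraph Γ) i))
  rw [map_mul, map_mul] at h
  exact h

lemma vertex_mul_vertex {i j : V} (hij : i ≠ j) : vertex k Γ C i * vertex k Γ C j = 0 := by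
  have h := congrArg (ofDouble k Γ C)
    (PathAlgebra.mk_rel (PathRel.orth (k := k) (Q := DoubleGraph Γ) i j hij))
  rw [map_mul, map_mul, map_zero, map_zero] at h
  exact h

lemma vertex_mul_arrow {i j : DoubleGraph Γ} (a : i ⟶ j) :
    vertex k Γ C i * ofDouble k Γ C (PathAlgebra.arrow k a) =
      ofDouble k Γ C (PathAlgebra.arrow k a) := by
  have h := congrArg (ofDouble k Γ C) (PathAlgebra.mk_rel (PathRel.source (k := k) a))
  rw [map_mul, map_mul] at h
  exact h

lemma arrow_mul_vertex {i j : DoubleGraph Γ} (a : i ⟶ j) :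
    ofDouble k Γ C (PathAlgebra.arrow k a) * vertex k Γ C j =
      ofDouble k Γ C (PathAlgebra.arrow k a) := by
  have h := congrArg (ofDouble k Γ C) (PathAlgebra.mk_rel (PathRel.target (k := k) a))
  rw [map_mul, map_mul] at h
  exact h

lemma vertex_mul_edge (i j : V) : vertex k Γ C i * edge k Γ C i j = edge k Γ C i j := by
  by_cases h : Γ.Adj i j
  · rw [edge_eq C h]; exact vertex_mul_arrow C _
  · rw [edge_eq_zero C h, mul_zero]

lemma edge_mul_vertex (i j : V) : edge k Γ C i j * vertex k Γ C j = edge k Γ C i j := by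
  by_cases h : Γ.Adj i j
  · rw [edge_eq C h]; exact arrow_mul_vertex C _
  · rw [edge_eq_zero C h, zero_mul]

lemma vertex_mul_volume (i : V) : vertex k Γ C i * volume k Γ C i = volume k Γ C i := by
  unfold volume volumeElem
  split_ifs
  · exact vertex_mul_arrow C _
  · rw [map_sub, mul_sub]
    exact congrArg₂ _ (vertex_mul_arrow C _) (vertex_mul_arrow C _)

lemma volume_mul_vertex (i : V) : volume k Γ C i * vertex k Γ C i = volume k Γ C i := by
  unfold volume volumeElem
  split_ifs
  · exact arrow_mul_vertex C _
  · rw [map_sub, sub_mul]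
    exact congrArg₂ _ (arrow_mul_vertex C _) (arrow_mul_vertex C _)

lemma loopT_eq (i : V) :
    ofDouble k Γ C (loopTElem k Γ i) = -ofDouble k Γ C (loopSElem k Γ i) := by
  have h := ofDouble_rel C (ZigzagRel.loops_add (k := k) (Γ := Γ) i)
  rw [map_add, map_zero] at h
  exact eq_neg_of_add_eq_zero_right h

lemma loopS_mul_self (i : V) :
    ofDouble k Γ C (loopSElem k Γ i) * ofDouble k Γ C (loopSElem k Γ i) = 0 := by
  have h := ofDouble_rel C (ZigzagRel.loops_mul (k := k) (Γ := Γ) i)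
  rw [map_mul, loopT_eq, map_zero, mul_neg, neg_eq_zero] at h
  exact h

lemma loopS_eq (i : V) :
    ofDouble k Γ C (loopSElem k Γ i) = ZigzagModel.loopCoeff k • volume k Γ C i := by
  unfold volume volumeElem ZigzagModel.loopCoeff
  split_ifs with h
  · rw [one_smul]
  · rw [map_sub, loopT_eq, sub_neg_eq_add, ← two_smul k, smul_smul, inv_mul_cancel₀ h, one_smul]

lemma volume_mul_self (i : V) : volume k Γ C i * volume k Γ C i = 0 := by
  have h := loopS_mul_self (k := k) (Γ := Γ) C i
  have h0 : ZigzagModel.loopCoeff k ≠ 0 := by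
    unfold ZigzagModel.loopCoeff
    split_ifs with h
    · exact one_ne_zero
    · exact inv_ne_zero h
  rw [loopS_eq, smul_mul_assoc, mul_smul_comm, smul_smul, smul_eq_zero] at h
  exact h.resolve_left (mul_ne_zero h0 h0)

lemma edge_mul_edge {i j : V} (h : Γ.Adj i j) :
    edge k Γ C i j * edge k Γ C j i = volume k Γ C i := by
  rw [edge_eq C h, edge_eq C h.symm, ← map_mul]
  exact ofDouble_rel C (ZigzagRel.zigzag h)

lemma edge_mul_edge_of_ne {i j l : V} (h : i ≠ l) : edge k Γ C i j * edge k Γ C j l = 0 := by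
  by_cases hij : Γ.Adj i j
  swap
  · rw [edge_eq_zero C hij, zero_mul]
  by_cases hjl : Γ.Adj j l
  swap
  · rw [edge_eq_zero C hjl, mul_zero]
  let p : Quiver.Path (V := DoubleGraph Γ) i l :=
    (Quiver.Path.nil.cons (DoubleArrow.edge hij : @Quiver.Hom (DoubleGraph Γ) _ i j)).cons
      (DoubleArrow.edge hjl : @Quiver.Hom (DoubleGraph Γ) _ j l)
  have hp : DoubleGraph.MeetsThree p := by
    have hv : p.vertices = ([i, j, l] : List V) := rfl
    have hi : i ∈ ([i, j, l] : List V) := by simp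
    have hj : j ∈ ([i, j, l] : List V) := by simp
    have hl : l ∈ ([i, j, l] : List V) := by simp
    exact ⟨i, hv ▸ hi, j, hv ▸ hj, l, hv ▸ hl, hij.ne, h, hjl.ne⟩
  have h := ofDouble_rel (k := k) C (ZigzagRel.bounded p hp)
  rw [map_zero] at h
  rw [edge_eq C hij, edge_eq C hjl, ← h]
  have : ofDouble k Γ C (PathAlgebra.ofPath k p) =
    vertex k Γ C i * ofDouble k Γ C (edgeElem k Γ hij) * ofDouble k Γ C (edgeElem k Γ hjl) :=
    (map_mul _ _ _).trans (congrArg (· * _) (map_mul _ _ _))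
  rw [this, ← edge_eq C hij, vertex_mul_edge]

/-- A walk from `i` to a third vertex has to leave `{i, j}`. -/
lemma exists_adj_third (hΓ : Γ.Connected) {i j : V} (hV : Fintype.card V ≠ 2)
    (hij : Γ.Adj i j) : ∃ l, (l ≠ j ∧ Γ.Adj i l) ∨ (l ≠ i ∧ Γ.Adj j l) := by
  classical
  obtain ⟨m, hm⟩ : ∃ m, m ∉ ({i, j} : Finset V) := by
    by_contra! h
    apply hV
    rw [← Finset.card_univ, ← Finset.eq_univ_of_forall h, Finset.card_pair hij.ne]
  obtain ⟨p⟩ := hΓ.preconnected i m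
  obtain ⟨d, -, h1, h2⟩ := p.exists_boundary_dart {v | v ∈ ({i, j} : Finset V)} (by simp) hm
  have hd := d.adj
  simp only [Set.mem_ofPred_eq, Finset.mem_insert, Finset.mem_singleton, not_or] at h1 h2
  refine ⟨d.snd, ?_⟩
  rcases h1 with h1 | h1
  · exact Or.inl ⟨h2.2, h1 ▸ hd⟩
  · exact Or.inr ⟨h2.1, h1 ▸ hd⟩

/-- Connectedness matters here. On two vertices this is the extra degree-three relation. Otherwise a
third vertex `l` is adjacent to `i` or `j`, and rewriting the volume element at that vertex through
`l` creates a path with three distinct vertices. -/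
lemma volume_mul_edge (hΓ : Γ.Connected) (i j : V) :
    volume k Γ C i * edge k Γ C i j = 0 := by
  by_cases hij : Γ.Adj i j
  swap
  · rw [edge_eq_zero C hij, mul_zero]
  by_cases hV : Fintype.card V = 2
  · let a : @Quiver.Hom (DoubleGraph Γ) _ i j := DoubleArrow.edge hij
    let b : @Quiver.Hom (DoubleGraph Γ) _ j i := DoubleArrow.edge hij.symm
    let p : Quiver.Path (V := DoubleGraph Γ) i j := ((Quiver.Path.nil.cons a).cons b).cons a
    have h := ofDouble_rel (k := k) C (ZigzagRel.two_vertices hV p rfl)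
    rw [map_zero] at h
    have hp : ofDouble k Γ C (PathAlgebra.ofPath k p) =
        vertex k Γ C i * ofDouble k Γ C (edgeElem k Γ hij) *
          ofDouble k Γ C (edgeElem k Γ hij.symm) * ofDouble k Γ C (edgeElem k Γ hij) :=
      (map_mul _ _ _).trans (congrArg (· * _)
        ((map_mul _ _ _).trans (congrArg (· * _) (map_mul _ _ _))))
    rw [hp, ← edge_eq, ← edge_eq, vertex_mul_edge, edge_mul_edge C hij] at h
    exact h
  · obtain ⟨l, ⟨hl, hil⟩ | ⟨hl, hjl⟩⟩ := exists_adj_third hΓ hV hij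
    · rw [← edge_mul_edge C hil, mul_assoc, edge_mul_edge_of_ne C hl, mul_zero]
    · rw [← edge_mul_edge C hij, mul_assoc, edge_mul_edge C hij.symm, ← edge_mul_edge C hjl,
        ← mul_assoc, edge_mul_edge_of_ne C hl.symm, zero_mul]

lemma edge_mul_volume (hΓ : Γ.Connected) (i j : V) :
    edge k Γ C i j * volume k Γ C j = 0 := by
  by_cases hij : Γ.Adj i j
  · rw [← edge_mul_edge C hij.symm, ← mul_assoc, edge_mul_edge C hij, volume_mul_edge C hΓ]
  · rw [edge_eq_zero C hij, zero_mul]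

/-! ### The spanning set -/

variable (k Γ) in
/-- The span of the vertices, arrows and volume elements. -/
noncomputable def spanBasis : Submodule k (ZigzagAlgebraWith k Γ C) :=
  Submodule.span k (Set.range (vertex k Γ C) ∪ Set.range (fun p : V × V => edge k Γ C p.1 p.2) ∪
    Set.range (volume k Γ C))

lemma vertex_mem (i : V) : vertex k Γ C i ∈ spanBasis k Γ C :=
  Submodule.subset_span (Or.inl (Or.inl ⟨i, rfl⟩))

lemma edge_mem (i j : V) : edge k Γ C i j ∈ spanBasis k Γ C :=
  Submodule.subset_span (Or.inl (Or.inr ⟨(i, j), rfl⟩))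

lemma volume_mem (i : V) : volume k Γ C i ∈ spanBasis k Γ C :=
  Submodule.subset_span (Or.inr ⟨i, rfl⟩)

lemma spanBasis_induction {P : ZigzagAlgebraWith k Γ C → Prop}
    (hv : ∀ i, P (vertex k Γ C i)) (he : ∀ i j, P (edge k Γ C i j)) (hx : ∀ i, P (volume k Γ C i))
    (h0 : P 0) (hadd : ∀ y z, P y → P z → P (y + z)) (hsmul : ∀ (c : k) y, P y → P (c • y))
    {y : ZigzagAlgebraWith k Γ C} (hy : y ∈ spanBasis k Γ C) : P y := by
  refine Submodule.span_induction (p := fun y _ => P y) ?_ h0 (fun y z _ _ => hadd y z)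
    (fun c y _ => hsmul c y) hy
  rintro _ ((⟨i, rfl⟩ | ⟨p, rfl⟩) | ⟨i, rfl⟩)
  · exact hv i
  · exact he _ _
  · exact hx i

/-- Multiplication by an element that starts at the vertex `i`. -/
lemma mul_mem_of_vertex_mul {z : ZigzagAlgebraWith k Γ C} {i : V} (hz : vertex k Γ C i * z = z)
    (hzm : z ∈ spanBasis k Γ C) (he : ∀ l, edge k Γ C l i * z ∈ spanBasis k Γ C)
    (hx : volume k Γ C i * z ∈ spanBasis k Γ C)
    {y : ZigzagAlgebraWith k Γ C} (hy : y ∈ spanBasis k Γ C) : y * z ∈ spanBasis k Γ C := by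
  have hzero : ∀ l, l ≠ i → vertex k Γ C l * z = 0 := fun l hl => by
    rw [← hz, ← mul_assoc, vertex_mul_vertex C hl, zero_mul]
  refine spanBasis_induction C (P := fun y => y * z ∈ spanBasis k Γ C) (fun l => ?_)
    (fun l m => ?_) (fun l => ?_) ?_ (fun y y' h h' => ?_) (fun c y h => ?_) hy
  · by_cases hl : l = i
    · rw [hl, hz]; exact hzm
    · rw [hzero l hl]; exact Submodule.zero_mem _
  · by_cases hm : m = i
    · rw [hm]; exact he l
    · rw [← edge_mul_vertex, mul_assoc, hzero m hm, mul_zero]; exact Submodule.zero_mem _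
  · by_cases hl : l = i
    · rw [hl]; exact hx
    · rw [← volume_mul_vertex, mul_assoc, hzero l hl, mul_zero]; exact Submodule.zero_mem _
  · rw [zero_mul]; exact Submodule.zero_mem _
  · rw [add_mul]; exact Submodule.add_mem _ h h'
  · rw [smul_mul_assoc]; exact Submodule.smul_mem _ _ h

lemma mul_vertex_mem {y : ZigzagAlgebraWith k Γ C} (hy : y ∈ spanBasis k Γ C) (i : V) :
    y * vertex k Γ C i ∈ spanBasis k Γ C :=
  mul_mem_of_vertex_mul C (vertex_mul_self C i) (vertex_mem C i)
    (fun l => by rw [edge_mul_vertex]; exact edge_mem C l i)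
    (by rw [volume_mul_vertex]; exact volume_mem C i) hy

lemma mul_volume_mem (hΓ : Γ.Connected) {y : ZigzagAlgebraWith k Γ C} (hy : y ∈ spanBasis k Γ C)
    (i : V) : y * volume k Γ C i ∈ spanBasis k Γ C :=
  mul_mem_of_vertex_mul C (vertex_mul_volume C i) (volume_mem C i)
    (fun l => by rw [edge_mul_volume C hΓ]; exact Submodule.zero_mem _)
    (by rw [volume_mul_self]; exact Submodule.zero_mem _) hy

lemma mul_edge_mem (hΓ : Γ.Connected) {y : ZigzagAlgebraWith k Γ C} (hy : y ∈ spanBasis k Γ C)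
    (i j : V) : y * edge k Γ C i j ∈ spanBasis k Γ C :=
  mul_mem_of_vertex_mul C (vertex_mul_edge C i j) (edge_mem C i j)
    (fun l => by
      by_cases hl : l = j
      · subst hl
        by_cases h : Γ.Adj l i
        · rw [edge_mul_edge C h]; exact volume_mem C l
        · rw [edge_eq_zero C h, zero_mul]; exact Submodule.zero_mem _
      · rw [edge_mul_edge_of_ne C hl]; exact Submodule.zero_mem _)
    (by rw [volume_mul_edge C hΓ]; exact Submodule.zero_mem _) hy

lemma ofDouble_surjective : Function.Surjective (ofDouble k Γ C) :=
  (RingQuot.mkAlgHom_surjective k _).comp (RingQuot.mkAlgHom_surjective k _)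

lemma mul_arrow_mem (hΓ : Γ.Connected) {y : ZigzagAlgebraWith k Γ C} (hy : y ∈ spanBasis k Γ C)
    {i j : V} (a : DoubleArrow Γ i j) : y * ofDouble k Γ C
      (PathAlgebra.arrow k (Q := DoubleGraph Γ) (i := i) (j := j) a) ∈ spanBasis k Γ C := by
  cases a with
  | edge h =>
    have := mul_edge_mem C hΓ hy i j
    rw [edge_eq C h] at this
    exact this
  | loopS =>
    change y * ofDouble k Γ C (loopSElem k Γ i) ∈ _
    rw [loopS_eq, mul_smul_comm]
    exact Submodule.smul_mem _ _ (mul_volume_mem C hΓ hy i)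
  | loopT =>
    change y * ofDouble k Γ C (loopTElem k Γ i) ∈ _
    rw [loopT_eq, loopS_eq, mul_neg, mul_smul_comm]
    exact Submodule.neg_mem _ (Submodule.smul_mem _ _ (mul_volume_mem C hΓ hy i))

/-- The span contains `1` and is stable under right multiplication by all generators. -/
lemma spanBasis_eq_top (hΓ : Γ.Connected) : spanBasis k Γ C = ⊤ := by
  have key : ∀ f : FreeAlgebra k (PathGen (DoubleGraph Γ)), ∀ y ∈ spanBasis k Γ C,
      y * ofDouble k Γ C (PathAlgebra.mk k f) ∈ spanBasis k Γ C := by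
    intro f
    induction f using FreeAlgebra.induction with
    | grade0 c =>
      intro y hy
      rw [AlgHom.commutes, AlgHom.commutes, ← Algebra.commutes, ← Algebra.smul_def]
      exact Submodule.smul_mem _ _ hy
    | grade1 g =>
      intro y hy
      cases g with
      | vertex i => exact mul_vertex_mem C hy i
      | arrow a => exact mul_arrow_mem C hΓ hy a
    | mul f g hf hg =>
      intro y hy
      rw [map_mul, map_mul, ← mul_assoc]
      exact hg _ (hf y hy)
    | add f g hf hg =>
      intro y hy
      rw [map_add, map_add, mul_add]
      exact Submodule.add_mem _ (hf y hy) (hg y hy)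
  rw [eq_top_iff]
  rintro y -
  obtain ⟨p, rfl⟩ := ofDouble_surjective C y
  obtain ⟨f, rfl⟩ : ∃ f, PathAlgebra.mk k f = p := RingQuot.mkAlgHom_surjective k _ p
  have h1 : (1 : ZigzagAlgebraWith k Γ C) ∈ spanBasis k Γ C := by
    rw [← sum_vertex C]
    exact Submodule.sum_mem _ fun i _ => vertex_mem C i
  simpa using key f 1 h1

lemma finiteDimensional (hΓ : Γ.Connected) : FiniteDimensional k (ZigzagAlgebraWith k Γ C) := by
  refine ⟨?_⟩
  rw [← spanBasis_eq_top C hΓ]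
  exact Submodule.fg_span
    (((Set.finite_range _).union (Set.finite_range _)).union (Set.finite_range _))

/-! ### The isomorphism with the model -/

open ZigzagModel

lemma toModel_edge (i j : V) : ofZigzagAlgebraWith k Γ C (edge k Γ C i j) = A i j := by
  by_cases h : Γ.Adj i j
  · rw [edge_eq C h]
    exact (ofZigzagAlgebraWith_mk k Γ C _).trans (ofPathAlgebra_edge k Γ C h)
  · rw [edge_eq_zero C h, map_zero]
    ext <;> simp [A_a, h]

lemma toModel_volume (i : V) : ofZigzagAlgebraWith k Γ C (volume k Γ C i) = X i :=
  (ofZigzagAlgebraWith_mk k Γ C _).trans (ofPathAlgebra_volume k Γ C i)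

lemma toModel_surjective : Function.Surjective (ofZigzagAlgebraWith k Γ C) := by
  intro p
  refine ⟨∑ i, p.e i • vertex k Γ C i + ∑ i, ∑ j, p.a i j • edge k Γ C i j +
    ∑ i, p.x i • volume k Γ C i, ?_⟩
  simp only [map_add, map_sum, map_smul, toModel_edge, toModel_volume, ofZigzagAlgebraWith_vertex]
  exact (eq_sum p).symm

/-- The coordinates of the image reconstruct `y`: this identity is linear in `y` and holds on the
spanning set. No independence of the spanning set is needed beforehand. -/
lemma toModel_injective (hΓ : Γ.Connected) :
    Function.Injective (ofZigzagAlgebraWith k Γ C) := by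
  classical
  have key : ∀ y : ZigzagAlgebraWith k Γ C, y =
      ∑ i, (ofZigzagAlgebraWith k Γ C y).e i • vertex k Γ C i +
      ∑ i, ∑ j, (ofZigzagAlgebraWith k Γ C y).a i j • edge k Γ C i j +
      ∑ i, (ofZigzagAlgebraWith k Γ C y).x i • volume k Γ C i := by
    intro y
    have hy : y ∈ spanBasis k Γ C := spanBasis_eq_top (k := k) C hΓ ▸ Submodule.mem_top
    refine spanBasis_induction C (P := fun y => y =
      ∑ i, (ofZigzagAlgebraWith k Γ C y).e i • vertex k Γ C i +
      ∑ i, ∑ j, (ofZigzagAlgebraWith k Γ C y).a i j • edge k Γ C i j +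
      ∑ i, (ofZigzagAlgebraWith k Γ C y).x i • volume k Γ C i) (fun i => ?_) (fun i j => ?_)
      (fun i => ?_) ?_ (fun y z hy hz => ?_) (fun c y hy => ?_) hy
    · simp [ofZigzagAlgebraWith_vertex, E_e]
    · by_cases h : Γ.Adj i j
      · rw [toModel_edge, Finset.sum_eq_zero, zero_add, Finset.sum_eq_single i,
          Finset.sum_eq_single j, Finset.sum_eq_zero]
        · simp [A_a, h]
        · simp
        · intro b _ hb; simp [A_a, hb]
        · simp
        · intro b _ hb; simp [A_a, hb]
        · simp
        · simp
      · rw [toModel_edge, edge_eq_zero C h]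
        simp [A_a, h]
    · by_cases h : i ∈ C
      · rw [volume_eq_zero C h]; simp
      · simp [toModel_volume, X_x, h]
    · simp
    · nth_rewrite 1 [hy, hz]
      simp only [map_add, add_e, add_a, add_x, add_smul, Finset.sum_add_distrib]
      abel
    · nth_rewrite 1 [hy]
      simp only [map_smul, smul_e, smul_a, smul_x, smul_add, Finset.smul_sum, smul_smul]
  rw [injective_iff_map_eq_zero]
  intro y hy
  rw [key y, hy]
  simp

end ZigzagAlgebraWith

/-! ### Paths -/

section Graph

variable {V : Type u} {Γ : SimpleGraph V}

lemma SimpleGraph.Connected.exists_adj_of_ne (hΓ : Γ.Connected) {u v : V} (h : v ≠ u) :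
    ∃ w, Γ.Adj u w := by
  obtain ⟨p⟩ := hΓ.preconnected u v
  obtain ⟨d, -, h1, -⟩ := p.exists_boundary_dart {u} rfl h
  exact ⟨d.snd, (Set.mem_singleton_iff.1 h1) ▸ d.adj⟩

/-- Deleting pairwise non-adjacent leaves preserves connectedness. -/
lemma SimpleGraph.Connected.induce_compl_of_leaves (hΓ : Γ.Connected) {T : Set V}
    (hne : Tᶜ.Nonempty) (hind : ∀ c ∈ T, ∀ d ∈ T, ¬ Γ.Adj c d)
    (hleaf : ∀ c ∈ T, ∀ i j, Γ.Adj c i → Γ.Adj c j → i = j) : (Γ.induce Tᶜ).Connected := by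
  obtain ⟨v₀, hv₀⟩ := hne
  -- `ρ` retracts `Γ` onto the remaining vertices by collapsing each deleted leaf to its neighbour.
  -- An edge is either preserved or contracted, so walks survive.
  have hρ : ∀ v, ∃ w : ↥Tᶜ, (v ∈ T → Γ.Adj v w) ∧ (v ∉ T → w = v) := fun v => by
    by_cases hv : v ∈ T
    · obtain ⟨w, hw⟩ := hΓ.exists_adj_of_ne (u := v) (v := v₀) (by rintro rfl; exact hv₀ hv)
      exact ⟨⟨w, fun h => hind v hv w h hw⟩, fun _ => hw, fun h => absurd hv h⟩
    · exact ⟨⟨v, hv⟩, fun h => absurd h hv, fun _ => rfl⟩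
  choose ρ hρ1 hρ2 using hρ
  have hmixed : ∀ u v, u ∈ T → v ∉ T → Γ.Adj u v → ρ u = ρ v := fun u v hu hv h =>
    Subtype.ext ((hleaf u hu _ _ (hρ1 u hu) h).trans (hρ2 v hv).symm)
  have hadj : ∀ u v, Γ.Adj u v → (Γ.induce Tᶜ).Reachable (ρ u) (ρ v) := fun u v h => by
    by_cases hu : u ∈ T <;> by_cases hv : v ∈ T
    · exact absurd h (hind u hu v hv)
    · rw [hmixed u v hu hv h]
    · rw [hmixed v u hv hu h.symm]
    · refine SimpleGraph.Adj.reachable ?_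
      rw [SimpleGraph.comap_adj]
      simpa [hρ2 u hu, hρ2 v hv] using h
  have hreach : ∀ u v, Γ.Walk u v → (Γ.induce Tᶜ).Reachable (ρ u) (ρ v) := fun u v p => by
    induction p with
    | nil => exact SimpleGraph.Reachable.refl _
    | cons h _ ih => exact (hadj _ _ h).trans ih
  have : Nonempty ↥Tᶜ := ⟨⟨v₀, hv₀⟩⟩
  refine ⟨fun u v => ?_⟩
  obtain ⟨p⟩ := hΓ.preconnected u v
  have h := hreach u v p
  rwa [Subtype.ext (hρ2 u u.2), Subtype.ext (hρ2 v v.2)] at h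

/-- The reflection of a path. -/
def SimpleGraph.pathGraphRev (n : ℕ) :
    SimpleGraph.pathGraph (n + 1) ≃g SimpleGraph.pathGraph (n + 1) where
  toEquiv := Fin.revPerm
  map_rel_iff' {a b} := by
    simp only [SimpleGraph.pathGraph_adj, Fin.revPerm_apply, Fin.val_rev]
    omega

/-- Extending a path by a leaf at its initial vertex. -/
lemma SimpleGraph.exists_pathGraph_cons {n : ℕ} {c : V}
    (φ : SimpleGraph.pathGraph (n + 1) ≃g Γ.induce ({c} : Set V)ᶜ)
    (hc : ∀ v, Γ.Adj c v ↔ v = φ 0) :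
    ∃ ψ : SimpleGraph.pathGraph (n + 2) ≃g Γ, ψ 0 = c := by
  let f : Fin (n + 2) → V := Fin.cons c fun i => (φ i).1
  have hφ : ∀ i, (φ i).1 ≠ c := fun i => (φ i).2
  have hf : Function.Bijective f := by
    constructor
    · rw [Fin.cons_injective_iff]
      exact ⟨fun ⟨i, hi⟩ => hφ i hi, Subtype.val_injective.comp φ.injective⟩
    · intro v
      by_cases hv : v = c
      · exact ⟨0, hv.symm⟩
      · exact ⟨(φ.symm ⟨v, hv⟩).succ, by simp [f]⟩
  have hc' : ∀ i, Γ.Adj c (φ i) ↔ i = 0 := fun i => by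
    rw [hc, Subtype.val_inj, φ.injective.eq_iff]
  refine ⟨⟨Equiv.ofBijective f hf, fun {a b} => ?_⟩, rfl⟩
  simp only [Equiv.ofBijective_apply]
  refine Fin.cases ?_ (fun a => ?_) a <;> refine Fin.cases ?_ (fun b => ?_) b
  · simp
  · simp only [f, Fin.cons_zero, Fin.cons_succ, hc', SimpleGraph.pathGraph_adj, Fin.ext_iff]
    simp
  · simp only [f, Fin.cons_zero, Fin.cons_succ, SimpleGraph.adj_comm _ _ c, hc',
      SimpleGraph.pathGraph_adj, Fin.ext_iff]
    simp
  · simp only [f, Fin.cons_succ]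
    rw [show Γ.Adj (φ a) (φ b) ↔ (SimpleGraph.pathGraph (n + 1)).Adj a b from φ.map_adj_iff]
    simp [SimpleGraph.pathGraph_adj]

open ZigzagModel in
-- Each neighbour of `T` lies in the new condition, a single end vertex `w`. So every vertex of `T`
-- is attached to `w`, and `T` has one element because neighbours are not shared. Another element of
-- `C` would have to be `w`, which is excluded as a neighbour of `T`.
lemma exists_path_of_deletion (hΓ : Γ.Connected) {C T : Set V} (hTne : T.Nonempty)
    (hTC : T ⊆ C) (hind : ∀ c ∈ T, ∀ d ∈ T, ¬ Γ.Adj c d)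
    (hleaf : ∀ c ∈ T, ∀ j, Γ.Adj c j → j ∉ C ∧ ∀ l, Γ.Adj c l → l = j)
    (huniq : ∀ c ∈ T, ∀ d ∈ T, ∀ j, Γ.Adj c j → Γ.Adj d j → c = d)
    (h : ∃ (n : ℕ) (φ : SimpleGraph.pathGraph (n + 1) ≃g Γ.induce Tᶜ),
      deletionCondition Γ C T = {φ 0} ∨ deletionCondition Γ C T = {φ (Fin.last n)}) :
    ∃ (n : ℕ) (φ : SimpleGraph.pathGraph (n + 1) ≃g Γ), C = {φ 0} ∨ C = {φ (Fin.last n)} := by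
  obtain ⟨n, φ, hφ⟩ : ∃ (n : ℕ) (φ : SimpleGraph.pathGraph (n + 1) ≃g Γ.induce Tᶜ),
      deletionCondition Γ C T = {φ 0} := by
    obtain ⟨n, φ, h | h⟩ := h
    · exact ⟨n, φ, h⟩
    · refine ⟨n, (SimpleGraph.pathGraphRev n).trans φ, h.trans ?_⟩
      congr 2
  have hadj : ∀ c ∈ T, Γ.Adj c (φ 0) := fun c hc => by
    obtain ⟨w, hw⟩ := hΓ.exists_adj_of_ne (u := c) (v := φ 0)
      (fun h => (φ 0).2 (by rw [h]; exact hc))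
    have hwT : w ∉ T := fun h => hind c hc w h hw
    have : (⟨w, hwT⟩ : ↥Tᶜ) ∈ deletionCondition Γ C T := Or.inr ⟨c, hc, hw.symm⟩
    rw [hφ] at this
    rw [← Set.mem_singleton_iff.1 this]
    exact hw
  obtain ⟨c, hc⟩ := hTne
  obtain rfl : T = {c} :=
    Set.eq_singleton_iff_unique_mem.2 ⟨hc, fun d hd => huniq d hd c hc _ (hadj d hd) (hadj c hc)⟩
  have hC : C = {c} := by
    refine Set.eq_singleton_iff_unique_mem.2 ⟨hTC hc, fun d hd => ?_⟩
    by_contra hdc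
    have : (⟨d, hdc⟩ : ↥({c} : Set V)ᶜ) ∈ deletionCondition Γ C {c} := Or.inl hd
    rw [hφ] at this
    have h0 : d = φ 0 := congrArg Subtype.val (Set.mem_singleton_iff.1 this)
    exact (hleaf c hc _ (hadj c hc)).1 (h0 ▸ hd)
  obtain ⟨ψ, hψ⟩ := SimpleGraph.exists_pathGraph_cons φ fun v =>
    ⟨(hleaf c hc _ (hadj c hc)).2 v, by rintro rfl; exact hadj c hc⟩
  exact ⟨n + 1, ψ, Or.inl (hψ ▸ hC)⟩

end Graph

/-! ### The main theorem -/

open ZigzagModel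

/-- Induction on the number `d` of remaining steps, with the `l`-th quotient identified with a
model. The graph varies in the induction because each step deletes vertices. -/
lemma IsHereditaryChain.exists_path {k : Type w} [Field k] {R : Type (max u w)} [Ring R] {m : ℕ}
    {J : Fin (m + 1) → TwoSidedIdeal R} (hJ : IsHereditaryChain J) (d : ℕ) :
    ∀ l : Fin (m + 1), l.val + d = m → ∀ {V : Type u} [Fintype V] (Γ : SimpleGraph V) (C : Set V),
      Γ.Connected → ∀ Φ : R →+* ZigzagModel k Γ C, Function.Surjective Φ →
      RingHom.ker Φ = (J l).asIdeal →
      ∃ (n : ℕ) (φ : SimpleGraph.pathGraph (n + 1) ≃g Γ), C = {φ 0} ∨ C = {φ (Fin.last n)} := by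
  induction d with
  | zero =>
    intro l hl V _ Γ C hΓ Φ _ hker
    obtain rfl : l = Fin.last m := Fin.ext hl
    rw [hJ.last] at hker
    -- The quotient at the end of the chain is zero, whereas the model of a non-empty graph is not.
    have h1 : (1 : R) ∈ RingHom.ker Φ := by rw [hker]; trivial
    rw [RingHom.mem_ker, map_one] at h1
    obtain ⟨v⟩ := hΓ.nonempty
    exact absurd (congrArg (fun p => p.e v) h1) one_ne_zero
  | succ d ih =>
    intro l hl V _ Γ C hΓ Φ hΦ hker
    classical
    obtain ⟨l, rfl⟩ : ∃ l' : Fin m, l = l'.castSucc := ⟨⟨l, by omega⟩, rfl⟩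
    have hlt : J l.castSucc < J l.succ := hJ.strictMono l.castSucc_lt_succ
    have hK := (isHereditaryIdeal_map_iff hΦ hker _).1 (hJ.hereditary l)
    set K := (J l.succ).asIdeal.map Φ with hKdef
    have := hK.isTwoSided
    have hmemK : ∀ x, Φ x ∈ K ↔ x ∈ J l.succ := fun x => by
      rw [hKdef, Ideal.mem_map_iff_of_surjective Φ hΦ]
      refine ⟨fun ⟨y, hy, hxy⟩ => ?_, fun h => ⟨x, h, rfl⟩⟩
      have hker' : x - y ∈ (J l.castSucc).asIdeal := by
        rw [← hker, RingHom.mem_ker, map_sub, hxy, sub_self]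
      have := (J l.succ).add_mem (hlt.le (TwoSidedIdeal.mem_asIdeal.1 hker'))
        (TwoSidedIdeal.mem_asIdeal.1 hy)
      rwa [sub_add_cancel] at this
    have hKer := eq_ker_restrict_of_mul_self hK.mul_self
    obtain ⟨hTC, hind, hleaf, huniq⟩ := hK.combinatorics
    set T : Set V := {i | E i ∈ K}
    -- Strictness of the chain: deleting no vertex would give a zero ideal `K`.
    have hTne : T.Nonempty := by
      by_contra hempty
      have hempty : ∀ i, i ∉ T := fun i hi => hempty ⟨i, hi⟩
      refine hlt.not_ge fun x hx => ?_
      have hx' := (hmemK x).2 hx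
      rw [hKer, mem_ker_restrict] at hx'
      rw [← TwoSidedIdeal.mem_asIdeal, ← hker, RingHom.mem_ker]
      exact ext_of (fun i => hx'.1 i (hempty i)) (fun i j _ => hx'.2.1 i (hempty i) j (hempty j))
        fun i hi => hx'.2.2 i (hempty i) hi fun t ht => absurd ht (hempty t)
    by_cases hTc : Tᶜ.Nonempty
    · refine exists_path_of_deletion hΓ hTne hTC (fun c hc d hd => hind c d hc hd)
        (fun c hc j => hleaf c j hc) (fun c hc d hd j => huniq c d j hc hd) ?_
      refine ih l.succ (by simp at hl ⊢; omega) _ _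
        (hΓ.induce_compl_of_leaves hTc (fun c hc d hd => hind c d hc hd)
          fun c hc i j hi hj => (hleaf c j hc hj).2 i hi)
        ((restrict T).comp Φ) ((restrict_surjective T).comp hΦ) ?_
      ext x
      rw [TwoSidedIdeal.mem_asIdeal, ← hmemK x]
      exact (SetLike.ext_iff.1 hKer (Φ x)).symm
    -- All vertices are deleted at once. They are pairwise non-adjacent, so connectedness leaves a
    -- single vertex.
    · have hall : ∀ v, v ∈ T := fun v => by
        by_contra hv
        exact hTc ⟨v, hv⟩
      obtain ⟨v⟩ := hΓ.nonempty
      have hv : ∀ u, u = v := fun u => by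
        by_contra hu
        obtain ⟨w, hw⟩ := hΓ.exists_adj_of_ne hu
        exact hind v w (hall v) (hall w) hw
      have hsub : Subsingleton V := ⟨fun a b => (hv a).trans (hv b).symm⟩
      have : Subsingleton (Fin (0 + 1)) := inferInstanceAs (Subsingleton (Fin 1))
      refine ⟨0, ⟨⟨fun _ => v, fun _ => 0, fun _ => Subsingleton.elim _ _,
        fun _ => (hv _).symm⟩, fun {a b} => ?_⟩, Or.inl ?_⟩
      · simp [Subsingleton.elim a b]
      · exact Set.eq_singleton_iff_unique_mem.2 ⟨hTC v (hall v), fun u _ => hv u⟩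

lemma ZigzagModel.restrict_E {k : Type w} [Field k] {V : Type u} [Fintype V] {Γ : SimpleGraph V}
    {C T : Set V} [Fintype ↥Tᶜ] (i : ↥Tᶜ) :
    restrict T (E i.1 : ZigzagModel k Γ C) = E i := by
  classical
  refine ext_of (fun j => ?_) (fun _ _ _ => rfl) (fun j hj => ?_)
  · simp [E_e, Subtype.ext_iff]
  · rw [restrict_x T _ hj]; rfl

/-! ### The hereditary chain along a path -/

section Chain

variable {k : Type w} [Field k] {V : Type u} {Γ : SimpleGraph V} {C : Set V} {n : ℕ}
  (φ : SimpleGraph.pathGraph (n + 1) ≃g Γ)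

/-- The first `l` vertices of a path. -/
def initialVertices (l : ℕ) : Set V := {v | (φ.symm v).val < l}

lemma mem_initialVertices {l : ℕ} {j : Fin (n + 1)} : φ j ∈ initialVertices φ l ↔ j.val < l := by
  simp [initialVertices]

variable [Fintype V]

noncomputable instance (l : ℕ) : Fintype ↥(initialVertices φ l)ᶜ := Fintype.ofFinite _

variable (k C) in
/-- The two-sided ideal generated by the sum of the first `l` idempotents along a path. -/
noncomputable def pathIdeal (l : ℕ) : TwoSidedIdeal (ZigzagAlgebraWith k Γ C) :=
  TwoSidedIdeal.span {∑ j : Fin (n + 1) with j.val < l, ZigzagAlgebraWith.vertex k Γ C (φ j)}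

lemma vertex_mem_pathIdeal {l : ℕ} {j : Fin (n + 1)} (hj : j.val < l) :
    ZigzagAlgebraWith.vertex k Γ C (φ j) ∈ pathIdeal k C φ l := by
  have h : ZigzagAlgebraWith.vertex k Γ C (φ j) = ZigzagAlgebraWith.vertex k Γ C (φ j) *
      ∑ i : Fin (n + 1) with i.val < l, ZigzagAlgebraWith.vertex k Γ C (φ i) := by
    rw [Finset.mul_sum, Finset.sum_eq_single j, ZigzagAlgebraWith.vertex_mul_self]
    · intro i _ hi
      exact ZigzagAlgebraWith.vertex_mul_vertex C fun h => hi (φ.injective h).symm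
    · intro h
      exact absurd (by simpa using hj) h
  rw [h]
  exact TwoSidedIdeal.mul_mem_left _ _ _ (TwoSidedIdeal.subset_span rfl)

lemma pathIdeal_le {l : ℕ} {I : TwoSidedIdeal (ZigzagAlgebraWith k Γ C)}
    (h : ∀ j : Fin (n + 1), j.val < l → ZigzagAlgebraWith.vertex k Γ C (φ j) ∈ I) :
    pathIdeal k C φ l ≤ I := by
  rw [pathIdeal, TwoSidedIdeal.span_le, Set.singleton_subset_iff]
  exact sum_mem fun j hj => h j (Finset.mem_filter.1 hj).2

variable (k C) in
/-- The quotient map that deletes the first `l` vertices. -/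
noncomputable def deleteInitial (l : ℕ) : ZigzagAlgebraWith k Γ C →+*
    ZigzagModel k (Γ.induce (initialVertices φ l)ᶜ)
      (deletionCondition Γ C (initialVertices φ l)) :=
  (restrict (initialVertices φ l)).comp (ofZigzagAlgebraWith k Γ C).toRingHom

lemma deleteInitial_surjective (l : ℕ) : Function.Surjective (deleteInitial k C φ l) := by
  exact (restrict_surjective _).comp (ZigzagAlgebraWith.toModel_surjective C)

lemma deleteInitial_vertex_of_lt {l : ℕ} {j : Fin (n + 1)} (hj : j.val < l) :
    deleteInitial k C φ l (ZigzagAlgebraWith.vertex k Γ C (φ j)) = 0 := by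
  refine (congrArg (restrict (initialVertices φ l)) (ofZigzagAlgebraWith_vertex k Γ C _)).trans ?_
  exact E_mem_ker_restrict _ ((mem_initialVertices φ).2 hj)

lemma deleteInitial_vertex {l : ℕ} {j : Fin (n + 1)} (hj : φ j ∈ (initialVertices φ l)ᶜ) :
    deleteInitial k C φ l (ZigzagAlgebraWith.vertex k Γ C (φ j)) = E ⟨φ j, hj⟩ := by
  refine (congrArg (restrict (initialVertices φ l)) (ofZigzagAlgebraWith_vertex k Γ C _)).trans ?_
  exact restrict_E ⟨φ j, hj⟩

/-- The generation statement is known in the model. Injectivity of the comparison map carries it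
back to the presented algebra. -/
lemma ker_deleteInitial (hΓ : Γ.Connected) (l : ℕ) :
    RingHom.ker (deleteInitial k C φ l) = (pathIdeal k C φ l).asIdeal := by
  refine le_antisymm (fun x hx => ?_) ?_
  · let f := (ofZigzagAlgebraWith k Γ C).toRingHom
    have hf : Function.Surjective f := ZigzagAlgebraWith.toModel_surjective C
    have : RingHomSurjective f := ⟨hf⟩
    have h : f x ∈ (pathIdeal k C φ l).asIdeal.map f := by
      refine ker_restrict_le (initialVertices φ l) (fun t ht => ?_) hx
      obtain ⟨j, rfl⟩ := φ.surjective t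
      rw [← ofZigzagAlgebraWith_vertex]
      exact Ideal.mem_map_of_mem f (vertex_mem_pathIdeal φ ((mem_initialVertices φ).1 ht))
    obtain ⟨y, hy, hxy⟩ := (Ideal.mem_map_iff_of_surjective f hf).1 h
    exact ZigzagAlgebraWith.toModel_injective C hΓ hxy ▸ hy
  · exact fun x hx => (TwoSidedIdeal.mem_ker _).1 (pathIdeal_le φ
      (I := TwoSidedIdeal.ker (deleteInitial k C φ l))
      (fun j hj => (TwoSidedIdeal.mem_ker _).2 (deleteInitial_vertex_of_lt φ hj)) hx)

/-- Vertices are numbered from zero, so `φ l` is the first one left after deleting `l` vertices. It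
satisfies the condition, and its only possible neighbour `φ (l + 1)` is neither in `C` nor adjacent
to a deleted vertex. -/
lemma isHereditaryIdeal_pathIdeal (hΓ : Γ.Connected) (hC : C = {φ 0}) (l : Fin (n + 1)) :
    IsHereditaryIdeal ((pathIdeal k C φ (l + 1)).asIdeal.map
      (Ideal.Quotient.mk (pathIdeal k C φ l).asIdeal)) := by
  classical
  rw [isHereditaryIdeal_map_iff (deleteInitial_surjective φ l) (ker_deleteInitial φ hΓ l)]
  have hl : φ l ∈ (initialVertices φ l)ᶜ := fun h =>
    lt_irrefl _ ((mem_initialVertices φ).1 h)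
  set c : ↥(initialVertices φ l)ᶜ := ⟨φ l, hl⟩
  have hadj : ∀ i j, Γ.Adj (φ i) (φ j) ↔ i.val + 1 = j.val ∨ j.val + 1 = i.val := fun i j => by
    rw [φ.map_adj_iff, SimpleGraph.pathGraph_adj]
  have hnbr : ∀ v : ↥(initialVertices φ l)ᶜ, (Γ.induce (initialVertices φ l)ᶜ).Adj c v →
      ∃ j, v.1 = φ j ∧ l.val + 1 = j.val := by
    rintro ⟨v, hv⟩ h
    obtain ⟨j, rfl⟩ := φ.surjective v
    refine ⟨j, rfl, ?_⟩
    have h1 := (hadj l j).1 h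
    have h2 : ¬ j.val < l.val := fun h => hv ((mem_initialVertices φ).2 h)
    omega
  have key : IsHereditaryIdeal (RingHom.ker (restrict {c} : ZigzagModel k
      (Γ.induce (initialVertices φ l)ᶜ) (deletionCondition Γ C (initialVertices φ l)) →+* _)) := by
    refine isHereditaryIdeal_ker_restrict ?_ (fun v hv => ?_) fun v w hv hw => ?_
    -- The condition at `φ l` comes from `C` at the start and from the deleted neighbour `φ (l - 1)`
    -- afterwards.
    · by_cases h0 : l = 0
      · left
        simp [c, hC, h0]
      · right
        have hpos : 0 < l.val := Nat.pos_of_ne_zero fun h => h0 (Fin.ext h)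
        refine ⟨φ ⟨l.val - 1, by omega⟩, (mem_initialVertices φ).2 
          (show l.val - 1 < l.val by omega), ?_⟩
        exact (hadj _ _).2 (Or.inr (show l.val - 1 + 1 = l.val by omega))
    · obtain ⟨j, hj, hlj⟩ := hnbr v hv
      rintro (h | ⟨t, ht, h⟩)
      · rw [hC, hj, Set.mem_singleton_iff, φ.injective.eq_iff] at h
        rw [h] at hlj
        simp at hlj
      · obtain ⟨i, rfl⟩ := φ.surjective t
        rw [hj, hadj] at h
        have := (mem_initialVertices φ).1 ht
        omega
    · obtain ⟨i, hi, hli⟩ := hnbr v hv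
      obtain ⟨j, hj, hlj⟩ := hnbr w hw
      exact Subtype.ext (hi.trans ((congrArg φ (Fin.ext (hli.symm.trans hlj))).trans hj.symm))
  have heq : (pathIdeal k C φ (l + 1)).asIdeal.map (deleteInitial k C φ l) =
      RingHom.ker (restrict {c}) := by
    have : RingHomSurjective (deleteInitial k C φ l) := ⟨deleteInitial_surjective φ l⟩
    refine le_antisymm (Ideal.map_le_iff_le_comap.2 fun x hx => ?_) (ker_restrict_le {c} ?_)
    · refine (TwoSidedIdeal.mem_ker ((restrict {c}).comp (deleteInitial k C φ l))).1 (pathIdeal_le φ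
        (I := TwoSidedIdeal.ker ((restrict {c}).comp (deleteInitial k C φ l)))
        (fun j hj => (TwoSidedIdeal.mem_ker _).2 ?_) hx)
      rw [RingHom.comp_apply]
      rcases Nat.lt_succ_iff_lt_or_eq.1 hj with hj | hj
      · rw [deleteInitial_vertex_of_lt φ hj, map_zero]
      · obtain rfl : j = l := Fin.ext hj
        rw [deleteInitial_vertex φ hl]
        exact E_mem_ker_restrict {c} rfl
    · rintro t rfl
      rw [← deleteInitial_vertex φ hl]
      exact Ideal.mem_map_of_mem _ (vertex_mem_pathIdeal φ (Nat.lt_succ_self _))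
  rw [heq]
  exact key

lemma isHereditaryChain_pathIdeal (hΓ : Γ.Connected) (hC : C = {φ 0}) :
    IsHereditaryChain (m := n + 1) (fun l => pathIdeal k C φ l.val) where
  one_le := Nat.succ_pos n
  strictMono := by
    rw [Fin.strictMono_iff_lt_succ]
    intro l
    refine lt_of_le_of_ne (pathIdeal_le φ fun j hj => vertex_mem_pathIdeal φ ?_) fun h => ?_
    · simp at hj ⊢; omega
    -- If two consecutive ideals agreed, the smaller one would contain the idempotent at `φ l`,
    -- which is nonzero after deleting the first `l` vertices.
    · have h1 : ZigzagAlgebraWith.vertex k Γ C (φ l) ∈ pathIdeal k C φ l.val := by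
        have := vertex_mem_pathIdeal (k := k) (C := C) φ (l := l.succ.val) (j := l) (by simp)
        rw [← h] at this
        exact this
      have hl : φ l ∈ (initialVertices φ l)ᶜ := fun h =>
        lt_irrefl _ ((mem_initialVertices φ).1 h)
      rw [← TwoSidedIdeal.mem_asIdeal, ← ker_deleteInitial φ hΓ, RingHom.mem_ker,
        deleteInitial_vertex φ hl] at h1
      simpa using congrArg (fun p => p.e ⟨φ l, hl⟩) h1
  zero := le_bot_iff.1 (pathIdeal_le φ fun j hj => absurd hj (Nat.not_lt_zero _))
  last := by
    rw [eq_top_iff]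
    rintro x -
    have h1 : (1 : ZigzagAlgebraWith k Γ C) ∈ pathIdeal k C φ (n + 1) := by
      rw [← ZigzagAlgebraWith.sum_vertex C, ← φ.toEquiv.sum_comp]
      exact sum_mem fun j _ => vertex_mem_pathIdeal φ j.2
    simpa using (pathIdeal k C φ (n + 1)).mul_mem_left x 1 h1
  hereditary l := by simpa using isHereditaryIdeal_pathIdeal φ hΓ hC l

end Chain

theorem theoremB (k : Type w) [Field k] {V : Type u} [Fintype V] (Γ : SimpleGraph V)
    (hΓ : Γ.Connected) (C : Set V) (hC : C.Nonempty) :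
    (IsQuasiHereditary k (ZigzagAlgebraWith k Γ C) ↔
      ∃ (n : ℕ) (φ : SimpleGraph.pathGraph (n + 1) ≃g Γ), C = {φ 0} ∨ C = {φ (Fin.last n)}) ∧
    (∀ (n : ℕ) (φ : SimpleGraph.pathGraph (n + 1) ≃g Γ), C = {φ 0} →
      IsHereditaryChain (m := n + 1) (fun l =>
        TwoSidedIdeal.span
          {∑ j : Fin (n + 1) with j.val < l.val, ZigzagAlgebraWith.vertex k Γ C (φ j)})) := by
  refine ⟨⟨?_, ?_⟩, fun n φ h => isHereditaryChain_pathIdeal φ hΓ h⟩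
  · rintro ⟨-, m, J, hJ⟩
    -- The induction starts at `J 0 = ⊥`, the kernel of the isomorphism with the model.
    refine hJ.exists_path m 0 (by simp) Γ C hΓ (ofZigzagAlgebraWith k Γ C).toRingHom
      (ZigzagAlgebraWith.toModel_surjective C) ?_
    rw [hJ.zero, TwoSidedIdeal.bot_asIdeal, ← RingHom.injective_iff_ker_eq_bot]
    exact ZigzagAlgebraWith.toModel_injective C hΓ
  · rintro ⟨n, φ, h | h⟩
    · exact ⟨ZigzagAlgebraWith.finiteDimensional C hΓ, n + 1, _,
        isHereditaryChain_pathIdeal φ hΓ h⟩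
    · refine ⟨ZigzagAlgebraWith.finiteDimensional C hΓ, n + 1, _,
        isHereditaryChain_pathIdeal ((SimpleGraph.pathGraphRev n).trans φ) hΓ (h.trans ?_)⟩
      congr 2
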